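/- Let $H_1,\dots,H_m$ ($m\ge 1$) be Hermitian operators on $n$ qubits with spectral norm $\|H_i\|\le 1$ (for example Pauli operators), let $\eta$ be an $n$-qubit density matrix, and for $\theta\in\mathbb{R}^m$ put $\rho_\theta=e^{\sum_i\theta_iH_i}/\mathrm{Tr}[e^{\sum_i\theta_iH_i}]$, $\langle A\rangle_\rho=\mathrm{Tr}[\rho A]$ and $f(\theta)=S(\eta\|\rho_\theta)=\mathrm{Tr}[\eta\log\eta]-\mathrm{Tr}[\eta\log\rho_\theta]$. Let $\alpha>0$, let $f$ be $\alpha$-strongly convex on a convex set $\Theta\subseteq\mathbb{R}^m$, and let $\theta^{\mathrm{opt}}\in\Theta$ be a global minimizer of $f$ on $\mathbb{R}^m$. Let $\kappa>0$, $\xi\ge0$, $\epsilon>0$ with $\kappa^2+\xi^2\ge\frac{\epsilon}{2m}$. Let $\theta^0\in\Theta$, $\delta_0=f(\theta^0)-f(\theta^{\mathrm{opt}})$, let $b\ge 4m$ (for example $b=4m^2$), and let $T$ be an integer with $$T\ \ge\ \frac{18m^2(\kappa^2+\xi^2)}{\alpha^2\epsilon^2}\qquad\text{and}\qquad T\ \ge\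 \frac{2b}{\alpha}\log\frac{4\delta_0}{\epsilon^2}$$ (the second condition is void if $\delta_0=0$). Run $T$ iterations of stochastic gradient descent $\theta^{t+1}=\theta^t-\gamma_t\hat g_t$ with the Khaled–Richtárik step sizes with maximal step $1/b$: with $k_0=\lceil T/2\rceil$, $\gamma_t=\frac1b$ if $T\le\frac b\alpha$ or $t<k_0$, and $\gamma_t=\frac{2}{\alpha(2b/\alpha+t-k_0)}$ otherwise. Here $\hat g_{t,i}=\hat h_{t,i}^{\rho}-\hat h_{t,i}^{\eta}$, where the square-integrable estimates $\hat h_{t,i}^{\rho}$ of $\langle H_i\rangle_{\rho_{\theta^t}}$ and $\hat h_{t,i}^{\eta}$ of $\langle H_i\rangle_\eta$ have root-mean-square errors at most $\kappa$ and $\xi$, and, given the past, are uncorrelated with each other for each $i$ and satisfy $\mathbb{E}[\hat g_t\mid\text{past}]=\nabla f(\theta^t)$. Assume that the iterates $\theta^0,\dots,\theta^T$ lie in $\Theta$ almost surely. Then $$\mathbb{E}\,\bigl|\langle H_i\rangle_{\rho_{\theta^T}}-\langle H_i\rangle_\eta\bigr|\le\epsilon\qquad\text{for all } i .$$ In particular,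 this holds with $T=\bigl\lceil 18m^2(\kappa^2+\xi^2)/(\alpha^2\epsilon^2)\bigr\rceil$ whenever $18m^2(\kappa^2+\xi^2)/(\alpha^2\epsilon^2)\ge\frac{2b}{\alpha}\log\frac{4\delta_0}{\epsilon^2}$. Moreover, if the $H_i$ are $n$-qubit Pauli operators (tensor products of $I,X,Y,Z$) and $\lambda\in(0,1)$, then $$N=\Bigl\lceil \frac{c}{\kappa^4}\log\frac{m}{1-\lambda^{1/T}}\Bigr\rceil$$ preparations of the Gibbs state suffice in each iteration, where $c>0$ is a universal constant: there is a measurement of $N$ copies of an $n$-qubit state, followed by classical post-processing, that for every state $\rho$ returns all $\langle H_i\rangle_\rho$, $i=1,\dots,m$, to precision $\kappa$ with probability at least $\lambda^{1/T}$; used on fresh copies of $\rho_{\theta^t}$ in each of the $T$ iterations, it succeeds in all of them with probability at least $\lambda$. -/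

import Mathlib

open MeasureTheory ProbabilityTheory
open scoped Matrix ComplexOrder

noncomputable section

namespace QBM

/-- Labels of the computational basis of `n` qubits; the Hilbert space is `ℂ^(Qubits n)`, of
dimension `2 ^ n`. -/
abbrev Qubits (n : ℕ) : Type := Fin n → Fin 2

/-- Operators on `n` qubits. -/
abbrev Op (n : ℕ) : Type := Matrix (Qubits n) (Qubits n) ℂ

/-- Density matrices: positive semidefinite with unit trace. -/
def IsDensity {n : ℕ} (ρ : Op n) : Prop := ρ.PosSemidef ∧ ρ.trace = 1

/-- The expectation value `⟨A⟩_ρ = Tr[ρ A]` (real for Hermitian `A` and a density matrix `ρ`). -/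
def expVal {n : ℕ} (A ρ : Op n) : ℝ := (Matrix.trace (ρ * A)).re

/-- The spectral norm (the operator norm induced by the Euclidean vector norm). -/
def specNorm {n : ℕ} (A : Op n) : ℝ := ‖Matrix.toEuclideanCLM (𝕜 := ℂ) A‖

/-- The single-qubit matrices `I, X, Y, Z`. -/
def pauli : Fin 4 → Matrix (Fin 2) (Fin 2) ℂ :=
  ![1, !![0, 1; 1, 0], !![0, -Complex.I; Complex.I, 0], !![1, 0; 0, -1]]

/-- The `n`-qubit Pauli operator `σ_{p 0} ⊗ ⋯ ⊗ σ_{p (n-1)}`. -/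
def pauliString {n : ℕ} (p : Fin n → Fin 4) : Op n :=
  Matrix.of fun x y => ∏ k, pauli (p k) (x k) (y k)

/-- The parameterized Hamiltonian `∑ i, θ i • H i`. -/
def hamiltonian {n m : ℕ} (H : Fin m → Op n) (θ : EuclideanSpace ℝ (Fin m)) : Op n :=
  ∑ i, ((θ i : ℝ) : ℂ) • H i

/-- The fully visible quantum Boltzmann machine `ρ_θ = exp(H_θ) / Tr[exp(H_θ)]`. -/
def gibbs {n m : ℕ} (H : Fin m → Op n) (θ : EuclideanSpace ℝ (Fin m)) : Op n :=
  (Matrix.trace (NormedSpace.exp (hamiltonian H θ)))⁻¹ • NormedSpace.exp (hamiltonian H θ)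

/-- The quantum relative entropy `S(η‖ρ) = Tr[η log η] - Tr[η log ρ]` for a density matrix `η` and
a positive definite density matrix `ρ` (every Gibbs state is one). The logarithm is the natural one,
applied to the eigenvalues; since `Real.log 0 = 0`, the first term follows `0 log 0 = 0`. -/
def relEntropy {n : ℕ} (η ρ : Op n) : ℝ :=
  (Matrix.trace (η * cfc Real.log η) - Matrix.trace (η * cfc Real.log ρ)).re

/-- The training loss `θ ↦ S(η‖ρ_θ)`. -/
def loss {n m : ℕ} (H : Fin m → Op n) (η : Op n) (θ : EuclideanSpace ℝ (Fin m)) : ℝ :=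
  relEntropy η (gibbs H θ)

/-- The Khaled–Richtárik step sizes with horizon `T`, maximal step `1 / b` and rate `a`: with
`k₀ = ⌈T/2⌉` and `s = 2 b / a`, the step is `1 / b` if `T ≤ b / a` or `t < k₀`, and
`2 / (a (s + t - k₀))` otherwise. -/
def stepSize (a b : ℝ) (T t : ℕ) : ℝ :=
  if (T : ℝ) ≤ b / a ∨ t < ⌈(T : ℝ) / 2⌉₊ then 1 / b
  else 2 / (a * (2 * b / a + (t : ℝ) - (⌈(T : ℝ) / 2⌉₊ : ℝ)))

/-- `T` iterations of stochastic gradient descent on `θ ↦ S(η‖ρ_θ)`, started at `θ₀`.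
`ℱ t` is the information available before iteration `t`, `hρ t ω i` and `hη t ω i` are the
estimates of `⟨H i⟩` in the current model and in the target that iteration `t` uses. -/
structure IsSGDRun {n m : ℕ} (H : Fin m → Op n) (η : Op n) (γ : ℕ → ℝ) (κ ξ : ℝ)
    (θ₀ : EuclideanSpace ℝ (Fin m)) (T : ℕ)
    {Ω : Type*} [mΩ : MeasurableSpace Ω] (μ : Measure Ω) (ℱ : Filtration ℕ mΩ)
    (θ : ℕ → Ω → EuclideanSpace ℝ (Fin m)) (hρ hη : ℕ → Ω → Fin m → ℝ) : Prop where
  init : ∀ᵐ ω ∂μ, θ 0 ω = θ₀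
  adapted : ∀ t, StronglyMeasurable[ℱ t] (θ t)
  memLp_model : ∀ t < T, ∀ i, MemLp (fun ω => hρ t ω i) 2 μ
  memLp_data : ∀ t < T, ∀ i, MemLp (fun ω => hη t ω i) 2 μ
  /-- The stochastic gradient `hρ - hη` is unbiased, given the past. -/
  unbiased : ∀ t < T, ∀ i,
    μ[fun ω => hρ t ω i - hη t ω i | ℱ t] =ᵐ[μ] fun ω => (gradient (loss H η) (θ t ω)) i
  /-- The measurements on the model and the mini-batch from the data set are drawn independently;
  only that they are uncorrelated given the past is required. -/
  uncorrelated : ∀ t < T, ∀ i,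
    μ[fun ω => hρ t ω i * hη t ω i | ℱ t] =ᵐ[μ]
      fun ω => (μ[fun ω' => hρ t ω' i | ℱ t]) ω * (μ[fun ω' => hη t ω' i | ℱ t]) ω
  /-- The model expectations are estimated to precision `κ` (in root mean square). -/
  precision_model : ∀ t < T, ∀ i,
    ∫ ω, (hρ t ω i - expVal (H i) (gibbs H (θ t ω))) ^ 2 ∂μ ≤ κ ^ 2
  /-- The target expectations are estimated to precision `ξ` (in root mean square). -/
  precision_data : ∀ t < T, ∀ i, ∫ ω, (hη t ω i - expVal (H i) η) ^ 2 ∂μ ≤ ξ ^ 2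
  update : ∀ t < T, ∀ᵐ ω ∂μ, ∀ i,
    θ (t + 1) ω i = θ t ω i - γ t * (hρ t ω i - hη t ω i)

/-- The state `ρ ⊗ ⋯ ⊗ ρ` of `N` preparations of `ρ`. -/
def copies {n : ℕ} (N : ℕ) (ρ : Op n) : Matrix (Fin N → Qubits n) (Fin N → Qubits n) ℂ :=
  Matrix.of fun x y => ∏ k, ρ (x k) (y k)

/-- A procedure that consumes `N` preparations of an unknown `n`-qubit state and returns `m` real
numbers: a measurement (POVM) with finitely many outcomes on the `N` preparations together,
followed by classical post-processing. -/
structure Protocol (n N m : ℕ) where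
  numOutcomes : ℕ
  effect : Fin numOutcomes → Matrix (Fin N → Qubits n) (Fin N → Qubits n) ℂ
  posSemidef : ∀ x, (effect x).PosSemidef
  sum_effect : ∑ x, effect x = 1
  estimate : Fin numOutcomes → Fin m → ℝ

/-- The Born probability of outcome `x` when the procedure is applied to `N` preparations of `ρ`. -/
def Protocol.prob {n N m : ℕ} (M : Protocol n N m) (ρ : Op n) (x : Fin M.numOutcomes) : ℝ :=
  (Matrix.trace (M.effect x * copies N ρ)).re

/-- Outcome `x` yields all expectations `⟨H i⟩_ρ` to precision `κ`. -/
def Protocol.Good {n N m : ℕ} (M : Protocol n N m) (H : Fin m → Op n) (κ : ℝ) (ρ : Op n)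
    (x : Fin M.numOutcomes) : Prop :=
  ∀ i, |M.estimate x i - expVal (H i) ρ| ≤ κ

open Classical in
/-- The probability that the procedure yields all expectations `⟨H i⟩_ρ` to precision `κ`. -/
def Protocol.successProb {n N m : ℕ} (M : Protocol n N m) (H : Fin m → Op n) (κ : ℝ)
    (ρ : Op n) : ℝ :=
  ∑ x with M.Good H κ ρ x, M.prob ρ x

end QBM

end

/-! The loss is a constant minus a linear functional of `θ` plus the free energy `log Tr exp(H_θ)`;
its gradient is the vector of mismatches `⟨H i⟩_{ρ_θ} - ⟨H i⟩_η`. What is needed is a second-order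
expansion of the free energy. Writing traces in the eigenbases of `X` and `Y`, with squared overlaps
as weights, turns them into averages over pairs of eigenvalues, where scalar inequalities for `exp`
apply. Jensen's inequality gives the lower bound `log_partitionFn_ge`; `log_partitionFn_le` gives
the upper bound with remainder `‖B‖² / 2`. So the loss is convex and `m`-smooth, with curvature at
most `1` along each coordinate axis.

A gradient step along one coordinate yields `g_i² ≤ 2 (f - f_opt)` (`sq_lossGrad_le`), and strong
convexity yields the Polyak–Łojasiewicz inequality. One stochastic step then contracts the expected
gap by `1 - αγ` and adds `m² (κ² + ξ²) γ² / 2`. The step sizes bring the final gap below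
`exp(-αT/(2b)) δ₀ + 4 m² (κ² + ξ²) / (α² T)` (`le_of_stepSize_recursion`). The two conditions on `T`
make each term at most `ε² / 4`, so `E g_i² ≤ ε²` and `E |g_i| ≤ ε`.

For Pauli operators, Bell sampling on pairs of copies estimates every `⟨P⟩_ρ²` at once. Some state
`σ` reproducing these squares is computed classically, and measuring further copies in the Pauli
rotations of `σ` estimates every `⟨P⟩_σ ⟨P⟩_ρ`; dividing by the known `⟨P⟩_σ` recovers `⟨P⟩_ρ` with
its sign (`exists_protocol_pauli`). Hoeffding and a union bound give `log m / κ⁴` copies. As the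
guarantee holds for every state, it multiplies over adaptively chosen rounds. -/

namespace QBM

/-! ### Traces of functions of two Hermitian matrices -/

section Spectral

variable {ι : Type*} [Fintype ι] [DecidableEq ι] {X Y : Matrix ι ι ℂ}

/-- `f(X)` for a Hermitian matrix `X`, through its eigenbasis. -/
noncomputable def specFn (hX : X.IsHermitian) (f : ℝ → ℝ) : Matrix ι ι ℂ :=
  (hX.eigenvectorUnitary : Matrix ι ι ℂ) *
    Matrix.diagonal (fun i => (f (hX.eigenvalues i) : ℂ)) *
    star (hX.eigenvectorUnitary : Matrix ι ι ℂ)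

/-- The squared overlaps of the eigenbases of two Hermitian matrices. -/
noncomputable def overlap (hX : X.IsHermitian) (hY : Y.IsHermitian) (i j : ι) : ℝ :=
  Complex.normSq ((star (hX.eigenvectorUnitary : Matrix ι ι ℂ) *
    (hY.eigenvectorUnitary : Matrix ι ι ℂ)) i j)

lemma overlap_nonneg (hX : X.IsHermitian) (hY : Y.IsHermitian) (i j : ι) :
    0 ≤ overlap hX hY i j := Complex.normSq_nonneg _

lemma specFn_id (hX : X.IsHermitian) : specFn hX (fun x => x) = X := by
  conv_rhs => rw [hX.spectral_theorem]
  rfl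

lemma specFn_one (hX : X.IsHermitian) : specFn hX (fun _ => 1) = 1 := by
  simp [specFn]

lemma specFn_mul (hX : X.IsHermitian) (f g : ℝ → ℝ) :
    specFn hX f * specFn hX g = specFn hX (fun x => f x * g x) := by
  have h : star (hX.eigenvectorUnitary : Matrix ι ι ℂ) *
      (hX.eigenvectorUnitary : Matrix ι ι ℂ) = 1 := by simp
  unfold specFn
  calc _ = (hX.eigenvectorUnitary : Matrix ι ι ℂ) *
        Matrix.diagonal (fun i => (f (hX.eigenvalues i) : ℂ)) *
        (star (hX.eigenvectorUnitary : Matrix ι ι ℂ) *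
          (hX.eigenvectorUnitary : Matrix ι ι ℂ)) *
        Matrix.diagonal (fun i => (g (hX.eigenvalues i) : ℂ)) *
        star (hX.eigenvectorUnitary : Matrix ι ι ℂ) := by simp only [Matrix.mul_assoc]
    _ = _ := by
        rw [h, Matrix.mul_one, Matrix.mul_assoc _ (Matrix.diagonal _) (Matrix.diagonal _),
          Matrix.diagonal_mul_diagonal]
        simp

lemma specFn_exp (hX : X.IsHermitian) : specFn hX Real.exp = NormedSpace.exp X := by
  have hu : IsUnit (hX.eigenvectorUnitary : Matrix ι ι ℂ) :=
    (Unitary.toUnits hX.eigenvectorUnitary).isUnit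
  have hinv : (hX.eigenvectorUnitary : Matrix ι ι ℂ)⁻¹ =
      star (hX.eigenvectorUnitary : Matrix ι ι ℂ) :=
    Matrix.inv_eq_right_inv (by simp)
  conv_rhs => rw [← specFn_id hX]
  unfold specFn
  rw [← hinv, Matrix.exp_conj _ _ hu, Matrix.exp_diagonal]
  congr 3
  ext i
  rw [Pi.coe_exp, ← Complex.exp_eq_exp_ℂ, Complex.ofReal_exp]

/-- With `W = U* V` the trace is `∑ f(x_i) W_ij g(y_j) conj(W_ij)`. The weights `|W_ij|²` act as a
joint law of the two spectra and stand in for commutativity. -/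
lemma trace_specFn_mul_specFn (hX : X.IsHermitian) (hY : Y.IsHermitian) (f g : ℝ → ℝ) :
    (specFn hX f * specFn hY g).trace =
      ((∑ i, ∑ j, overlap hX hY i j * (f (hX.eigenvalues i) * g (hY.eigenvalues j)) : ℝ) : ℂ) := by
  set U := (hX.eigenvectorUnitary : Matrix ι ι ℂ) with hU
  set V := (hY.eigenvectorUnitary : Matrix ι ι ℂ) with hV
  set a := Matrix.diagonal (fun i => (f (hX.eigenvalues i) : ℂ)) with ha
  set b := Matrix.diagonal (fun i => (g (hY.eigenvalues i) : ℂ)) with hb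
  have h1 : specFn hX f * specFn hY g = U * (a * (star U * V) * b * star V) := by
    simp only [specFn, Matrix.mul_assoc, ← hU, ← hV, ← ha, ← hb]
  have h2 : (U * (a * (star U * V) * b * star V)).trace =
      (a * (star U * V) * b * star (star U * V)).trace := by
    rw [Matrix.trace_mul_comm, star_mul, star_star]
    simp only [Matrix.mul_assoc]
  rw [h1, h2, Matrix.trace]
  push_cast
  refine Finset.sum_congr rfl fun i _ => ?_
  rw [Matrix.diag_apply, Matrix.mul_apply]
  refine Finset.sum_congr rfl fun j _ => ?_
  rw [ha, hb, Matrix.mul_diagonal, Matrix.diagonal_mul, overlap, ← hU, ← hV,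
    Matrix.star_apply, ← Complex.mul_conj]
  simp only [Complex.star_def]
  ring

end Spectral

/-! ### Second-order perturbation of the free energy -/

/-- The partition function `Tr[exp X]`. -/
noncomputable def partitionFn {ι : Type*} [Fintype ι] [DecidableEq ι] (X : Matrix ι ι ℂ) : ℝ :=
  (NormedSpace.exp X).trace.re

section Perturbation

variable {ι : Type*} [Fintype ι] [DecidableEq ι] {X Y : Matrix ι ι ℂ}

lemma partitionFn_eq_left (hX : X.IsHermitian) (hY : Y.IsHermitian) :
    partitionFn X = ∑ i, ∑ j, overlap hX hY i j * Real.exp (hX.eigenvalues i) := by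
  have h := trace_specFn_mul_specFn hX hY Real.exp (fun _ => 1)
  rw [specFn_one, Matrix.mul_one, specFn_exp] at h
  rw [partitionFn, h, Complex.ofReal_re]; simp

lemma partitionFn_eq_right (hX : X.IsHermitian) (hY : Y.IsHermitian) :
    partitionFn Y = ∑ i, ∑ j, overlap hX hY i j * Real.exp (hY.eigenvalues j) := by
  have h := trace_specFn_mul_specFn hX hY (fun _ => 1) Real.exp
  rw [specFn_one, Matrix.one_mul, specFn_exp] at h
  rw [partitionFn, h, Complex.ofReal_re]; simp

lemma trace_exp_eq (hX : X.IsHermitian) : (NormedSpace.exp X).trace = (partitionFn X : ℂ) := by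
  have h := trace_specFn_mul_specFn hX hX Real.exp (fun _ => 1)
  rw [specFn_one, Matrix.mul_one, specFn_exp] at h
  rw [partitionFn, h, Complex.ofReal_re]

lemma partitionFn_pos [Nonempty ι] (hX : X.IsHermitian) : 0 < partitionFn X := by
  have h : (NormedSpace.exp X).trace =
      ((∑ i, Real.exp (hX.eigenvalues i) : ℝ) : ℂ) := by
    rw [← specFn_exp hX, specFn, Matrix.mul_assoc, Matrix.trace_mul_comm, Matrix.mul_assoc]
    simp [Matrix.trace_diagonal]
  rw [partitionFn, h, Complex.ofReal_re]
  exact Finset.sum_pos (fun i _ => Real.exp_pos _) Finset.univ_nonempty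

lemma trace_exp_mul_sub (hX : X.IsHermitian) (hY : Y.IsHermitian) :
    (NormedSpace.exp X * (Y - X)).trace.re =
      ∑ i, ∑ j, overlap hX hY i j *
        (Real.exp (hX.eigenvalues i) * (hY.eigenvalues j - hX.eigenvalues i)) := by
  have h1 := trace_specFn_mul_specFn hX hY Real.exp (fun x => x)
  have h2 := trace_specFn_mul_specFn hX hY (fun x => Real.exp x * x) (fun _ => 1)
  rw [specFn_id, specFn_exp] at h1
  rw [specFn_one, Matrix.mul_one, ← specFn_mul hX Real.exp (fun x => x), specFn_id, specFn_exp] at h2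
  rw [Matrix.mul_sub, Matrix.trace_sub, h1, h2, ← Complex.ofReal_sub, Complex.ofReal_re]
  simp only [← Finset.sum_sub_distrib]
  exact Finset.sum_congr rfl fun i _ => Finset.sum_congr rfl fun j _ => by ring

/-- Since `f(X)` commutes with `X`, both cross terms of `(Y - X)²` have the same trace, so the
noncommutative square becomes a scalar square under the overlap weights. -/
lemma trace_specFn_mul_sub_sq (hX : X.IsHermitian) (hY : Y.IsHermitian) (f : ℝ → ℝ) :
    (specFn hX f * ((Y - X) * (Y - X))).trace.re =
      ∑ i, ∑ j, overlap hX hY i j *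
        (f (hX.eigenvalues i) * (hY.eigenvalues j - hX.eigenvalues i) ^ 2) := by
  have h1 := trace_specFn_mul_specFn hX hY f (fun x => x * x)
  have h2 := trace_specFn_mul_specFn hX hY (fun x => f x * x) (fun x => x)
  have h3 := trace_specFn_mul_specFn hX hY (fun x => f x * (x * x)) (fun _ => 1)
  rw [← specFn_mul hY (fun x => x) (fun x => x), specFn_id] at h1
  rw [← specFn_mul hX f (fun x => x), specFn_id, specFn_id] at h2
  rw [specFn_one, Matrix.mul_one, ← specFn_mul hX f (fun x => x * x),
    ← specFn_mul hX (fun x => x) (fun x => x), specFn_id] at h3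
  have hc : specFn hX f * X = X * specFn hX f := by
    have e1 := specFn_mul hX f (fun x => x)
    have e2 := specFn_mul hX (fun x => x) f
    rw [specFn_id] at e1 e2
    rw [e1, e2]
    simp only [mul_comm]
  have h4 : (specFn hX f * (Y * X)).trace = (specFn hX f * X * Y).trace := by
    rw [← Matrix.mul_assoc, Matrix.trace_mul_comm, ← Matrix.mul_assoc, ← hc]
  have h5 : specFn hX f * ((Y - X) * (Y - X)) = specFn hX f * (Y * Y) -
      specFn hX f * (Y * X) - specFn hX f * X * Y + specFn hX f * (X * X) := by
    noncomm_ring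
  rw [h5, Matrix.trace_add, Matrix.trace_sub, Matrix.trace_sub, h4, h1, h2, h3,
    ← Complex.ofReal_sub, ← Complex.ofReal_sub, ← Complex.ofReal_add, Complex.ofReal_re]
  simp only [← Finset.sum_sub_distrib, ← Finset.sum_add_distrib]
  exact Finset.sum_congr rfl fun i _ => Finset.sum_congr rfl fun j _ => by ring

lemma overlap_comm (hX : X.IsHermitian) (hY : Y.IsHermitian) (i j : ι) :
    overlap hY hX j i = overlap hX hY i j := by
  have : (star (hY.eigenvectorUnitary : Matrix ι ι ℂ) *
    (hX.eigenvectorUnitary : Matrix ι ι ℂ)) = star (star (hX.eigenvectorUnitary : Matrix ι ι ℂ) *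
    (hY.eigenvectorUnitary : Matrix ι ι ℂ)) := by simp
  rw [overlap, overlap, this, Matrix.star_apply, Complex.star_def, Complex.normSq_conj]

/-- The spectral norm of a Hermitian matrix bounds its second moment in any Gibbs state. -/
lemma trace_exp_mul_sq_le (hX : X.IsHermitian) {B : Matrix ι ι ℂ} (hB : B.IsHermitian) {β : ℝ}
    (hβ : ‖Matrix.toEuclideanCLM (𝕜 := ℂ) B‖ ≤ β) :
    (NormedSpace.exp X * (B * B)).trace.re ≤ β ^ 2 * partitionFn X := by
  set U := (hX.eigenvectorUnitary : Matrix ι ι ℂ) with hU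
  -- Column `i` of `B U` is `B` applied to the `i`-th unit eigenvector of `X`.
  have hcol : ∀ i, ∑ k, ‖(B * U) k i‖ ^ 2 ≤ β ^ 2 := by
    intro i
    have h1 : ∑ k, ‖(B * U) k i‖ ^ 2 =
        ‖Matrix.toEuclideanCLM (𝕜 := ℂ) B (hX.eigenvectorBasis i)‖ ^ 2 := by
      rw [EuclideanSpace.norm_sq_eq]
      rfl
    have h2 := (Matrix.toEuclideanCLM (𝕜 := ℂ) B).le_opNorm (hX.eigenvectorBasis i)
    rw [hX.eigenvectorBasis.orthonormal.1 i, mul_one] at h2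
    rw [h1]
    exact pow_le_pow_left₀ (norm_nonneg _) (h2.trans hβ) 2
  have h1 : (NormedSpace.exp X * (B * B)).trace =
      ((∑ i, Real.exp (hX.eigenvalues i) * ∑ k, ‖(B * U) k i‖ ^ 2 : ℝ) : ℂ) := by
    rw [← specFn_exp hX, specFn, ← hU, Matrix.mul_assoc, Matrix.mul_assoc, Matrix.trace_mul_comm,
      Matrix.mul_assoc, Matrix.trace]
    push_cast
    refine Finset.sum_congr rfl fun i _ => ?_
    rw [Matrix.diag_apply, Matrix.diagonal_mul]
    congr 1
    have h3 : star U * (B * B) * U = (B * U)ᴴ * (B * U) := by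
      rw [Matrix.conjTranspose_mul, hB.eq, Matrix.star_eq_conjTranspose]
      simp only [Matrix.mul_assoc]
    rw [h3, Matrix.mul_apply]
    refine Finset.sum_congr rfl fun k _ => ?_
    rw [Matrix.conjTranspose_apply, Complex.star_def, mul_comm, Complex.mul_conj,
      Complex.normSq_eq_norm_sq]
    push_cast
    rfl
  have h2 : partitionFn X = ∑ i, Real.exp (hX.eigenvalues i) := by
    have h := trace_exp_eq hX
    rw [← specFn_exp hX, specFn, Matrix.mul_assoc, Matrix.trace_mul_comm, Matrix.mul_assoc] at h
    have h' : (((∑ i, Real.exp (hX.eigenvalues i) : ℝ)) : ℂ) = (partitionFn X : ℂ) := by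
      rw [← h]; simp [Matrix.trace_diagonal]
    exact (Complex.ofReal_injective h').symm
  rw [h1, h2, Complex.ofReal_re, Finset.mul_sum]
  refine Finset.sum_le_sum fun i _ => ?_
  rw [mul_comm]
  exact mul_le_mul_of_nonneg_right (hcol i) (Real.exp_pos _).le

lemma exp_ge_tangent (m u : ℝ) : Real.exp m * (1 + (u - m)) ≤ Real.exp u := by
  have h := Real.add_one_le_exp (u - m)
  have h2 : Real.exp u = Real.exp m * Real.exp (u - m) := by rw [← Real.exp_add]; ring_nf
  rw [h2]
  exact mul_le_mul_of_nonneg_left (by linarith) (Real.exp_pos _).le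

/-- Taylor's integral remainder is `u² ∫₀¹ (1 - s) e^{su} ds`, and convexity bounds `e^{su}` by `(1
- s) + s e^u`, which gives weights `1/3` and `1/6`. Only the endpoint exponentials remain, and these
turn into Gibbs weights of `X` and `Y`. The proof uses that `G`, the difference of the two sides
times `6 e^{-u}`, has its minimum at `0`. -/
lemma exp_le_interpolation (u : ℝ) :
    Real.exp u ≤ 1 + u + (2 * u ^ 2 + u ^ 2 * Real.exp u) / 6 := by
  set G : ℝ → ℝ := fun x => (x ^ 2 - 6) + (2 * x ^ 2 + 6 * x + 6) * Real.exp (-x) with hG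
  have hd : ∀ x, HasDerivAt G (2 * x * (Real.exp (-x) * (Real.exp x - x - 1))) x := by
    intro x
    have h := ((hasDerivAt_pow 2 x).sub_const 6).add
      (((((hasDerivAt_pow 2 x).const_mul 2).add ((hasDerivAt_id x).const_mul 6)).add_const 6).mul
        (hasDerivAt_neg x).exp)
    refine h.congr_deriv ?_
    have : Real.exp (-x) * Real.exp x = 1 := by rw [← Real.exp_add]; simp
    simp only [Pi.add_apply, id]
    push_cast
    linear_combination (-2 * x) * this
  have hnn : ∀ x, 0 ≤ Real.exp (-x) * (Real.exp x - x - 1) := fun x =>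
    mul_nonneg (Real.exp_pos _).le (by linarith [Real.add_one_le_exp x])
  have hcont : Continuous G := continuous_iff_continuousAt.2 fun x => (hd x).continuousAt
  have hG0 : G 0 = 0 := by simp [hG]
  have hGu : 0 ≤ G u := by
    rcases le_total 0 u with h0 | h0
    · have hm : MonotoneOn G (Set.Ici 0) := monotoneOn_of_deriv_nonneg (convex_Ici 0)
        hcont.continuousOn (fun x _ => (hd x).differentiableAt.differentiableWithinAt)
        (fun x hx => by
          rw [interior_Ici] at hx
          rw [(hd x).deriv]
          exact mul_nonneg (by linarith [Set.mem_Ioi.1 hx]) (hnn x))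
      rw [← hG0]
      exact hm (Set.mem_Ici.2 le_rfl) h0 h0
    · have hm : AntitoneOn G (Set.Iic 0) := antitoneOn_of_deriv_nonpos (convex_Iic 0)
        hcont.continuousOn (fun x _ => (hd x).differentiableAt.differentiableWithinAt)
        (fun x hx => by
          rw [interior_Iic] at hx
          rw [(hd x).deriv]
          exact mul_nonpos_of_nonpos_of_nonneg (by linarith [Set.mem_Iio.1 hx]) (hnn x))
      rw [← hG0]
      exact hm h0 (Set.mem_Iic.2 le_rfl) h0
  have h1 : Real.exp u * G u = (u ^ 2 - 6) * Real.exp u + (2 * u ^ 2 + 6 * u + 6) := by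
    have : Real.exp u * Real.exp (-u) = 1 := by rw [← Real.exp_add]; simp
    simp only [hG]
    linear_combination (2 * u ^ 2 + 6 * u + 6) * this
  have h2 : 0 ≤ Real.exp u * G u := mul_nonneg (Real.exp_pos u).le hGu
  linarith

/-- A quantum Peierls–Bogoliubov inequality. -/
lemma log_partitionFn_ge [Nonempty ι] (hX : X.IsHermitian) (hY : Y.IsHermitian) :
    Real.log (partitionFn X) + (NormedSpace.exp X * (Y - X)).trace.re / partitionFn X ≤
      Real.log (partitionFn Y) := by
  have hZX := partitionFn_pos hX
  -- The tangent to `exp` is taken at the mean of `y_j - x_i`, so the linear term averages to zero: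
  -- this is Jensen's inequality.
  set m := (NormedSpace.exp X * (Y - X)).trace.re / partitionFn X with hm
  rw [Real.le_log_iff_exp_le (partitionFn_pos hY), Real.exp_add, Real.exp_log hZX]
  have hM : (NormedSpace.exp X * (Y - X)).trace.re = m * partitionFn X := by
    rw [hm]; field_simp
  have h : ∑ i, ∑ j, overlap hX hY i j * (Real.exp (hX.eigenvalues i) *
      (Real.exp m * (1 + ((hY.eigenvalues j - hX.eigenvalues i) - m)))) ≤ partitionFn Y := by
    rw [partitionFn_eq_right hX hY]
    refine Finset.sum_le_sum fun i _ => Finset.sum_le_sum fun j _ => ?_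
    refine mul_le_mul_of_nonneg_left ?_ (overlap_nonneg _ _ _ _)
    calc _ ≤ Real.exp (hX.eigenvalues i) * Real.exp (hY.eigenvalues j - hX.eigenvalues i) :=
          mul_le_mul_of_nonneg_left (exp_ge_tangent _ _) (Real.exp_pos _).le
      _ = _ := by rw [← Real.exp_add]; ring_nf
  refine le_trans (le_of_eq ?_) h
  have h2 : ∑ i, ∑ j, overlap hX hY i j * (Real.exp (hX.eigenvalues i) *
      (Real.exp m * (1 + ((hY.eigenvalues j - hX.eigenvalues i) - m)))) =
      Real.exp m * (1 - m) * partitionFn X +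
        Real.exp m * (NormedSpace.exp X * (Y - X)).trace.re := by
    rw [trace_exp_mul_sub hX hY, partitionFn_eq_left hX hY]
    simp only [Finset.mul_sum, ← Finset.sum_add_distrib]
    exact Finset.sum_congr rfl fun i _ => Finset.sum_congr rfl fun j _ => by ring
  rw [h2, hM]
  ring

/-- After `exp_le_interpolation` the remainder is a combination of second moments of `Y - X` in the
unnormalised Gibbs states of `X` and of `Y`, each controlled by `trace_exp_mul_sq_le`. -/
lemma partitionFn_le (hX : X.IsHermitian) (hY : Y.IsHermitian) {β : ℝ}
    (hβ : ‖Matrix.toEuclideanCLM (𝕜 := ℂ) (Y - X)‖ ≤ β) :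
    partitionFn Y ≤ partitionFn X + (NormedSpace.exp X * (Y - X)).trace.re +
      β ^ 2 * (2 * partitionFn X + partitionFn Y) / 6 := by
  have hB : (Y - X).IsHermitian := hY.sub hX
  have hB' : (X - Y).IsHermitian := hX.sub hY
  have e1 := trace_exp_mul_sq_le hX hB hβ
  have e2 : (NormedSpace.exp Y * ((X - Y) * (X - Y))).trace.re ≤ β ^ 2 * partitionFn Y :=
    trace_exp_mul_sq_le hY hB' (by rwa [← neg_sub Y X, map_neg, norm_neg])
  rw [← specFn_exp hX, trace_specFn_mul_sub_sq hX hY] at e1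
  rw [← specFn_exp hY, trace_specFn_mul_sub_sq hY hX, Finset.sum_comm] at e2
  simp only [overlap_comm hX hY] at e2
  have h : partitionFn Y ≤ ∑ i, ∑ j, overlap hX hY i j * (Real.exp (hX.eigenvalues i) *
      (1 + (hY.eigenvalues j - hX.eigenvalues i) +
        (2 * (hY.eigenvalues j - hX.eigenvalues i) ^ 2 +
          (hY.eigenvalues j - hX.eigenvalues i) ^ 2 *
            Real.exp (hY.eigenvalues j - hX.eigenvalues i)) / 6)) := by
    rw [partitionFn_eq_right hX hY]
    refine Finset.sum_le_sum fun i _ => Finset.sum_le_sum fun j _ => ?_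
    refine mul_le_mul_of_nonneg_left ?_ (overlap_nonneg _ _ _ _)
    calc Real.exp (hY.eigenvalues j) = Real.exp (hX.eigenvalues i) *
          Real.exp (hY.eigenvalues j - hX.eigenvalues i) := by rw [← Real.exp_add]; ring_nf
      _ ≤ _ := mul_le_mul_of_nonneg_left (exp_le_interpolation _) (Real.exp_pos _).le
  have h2 : ∑ i, ∑ j, overlap hX hY i j * (Real.exp (hX.eigenvalues i) *
      (1 + (hY.eigenvalues j - hX.eigenvalues i) +
        (2 * (hY.eigenvalues j - hX.eigenvalues i) ^ 2 +
          (hY.eigenvalues j - hX.eigenvalues i) ^ 2 *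
            Real.exp (hY.eigenvalues j - hX.eigenvalues i)) / 6)) =
      partitionFn X + (NormedSpace.exp X * (Y - X)).trace.re +
      (2 * (∑ i, ∑ j, overlap hX hY i j *
          (Real.exp (hX.eigenvalues i) * (hY.eigenvalues j - hX.eigenvalues i) ^ 2)) +
        ∑ i, ∑ j, overlap hX hY i j *
          (Real.exp (hY.eigenvalues j) * (hX.eigenvalues i - hY.eigenvalues j) ^ 2)) / 6 := by
    rw [trace_exp_mul_sub hX hY, partitionFn_eq_left hX hY]
    simp only [Finset.mul_sum, ← Finset.sum_add_distrib, Finset.sum_div]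
    refine Finset.sum_congr rfl fun i _ => Finset.sum_congr rfl fun j _ => ?_
    have e : Real.exp (hY.eigenvalues j) = Real.exp (hX.eigenvalues i) *
          Real.exp (hY.eigenvalues j - hX.eigenvalues i) := by rw [← Real.exp_add]; ring_nf
    rw [e]
    ring
  rw [h2] at h
  linarith

lemma abs_trace_exp_mul_sub_le (hX : X.IsHermitian) (hY : Y.IsHermitian) {β : ℝ}
    (hβ : ‖Matrix.toEuclideanCLM (𝕜 := ℂ) (Y - X)‖ ≤ β) :
    |(NormedSpace.exp X * (Y - X)).trace.re| ≤ β * partitionFn X := by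
  have hβ0 : 0 ≤ β := (norm_nonneg _).trans hβ
  have e1 := trace_exp_mul_sq_le hX (hY.sub hX) hβ
  rw [← specFn_exp hX, trace_specFn_mul_sub_sq hX hY] at e1
  have hZ : 0 ≤ partitionFn X := by
    rw [partitionFn_eq_left hX hY]
    exact Finset.sum_nonneg fun i _ => Finset.sum_nonneg fun j _ =>
      mul_nonneg (overlap_nonneg _ _ _ _) (Real.exp_pos _).le
  refine abs_le_of_sq_le_sq ?_ (mul_nonneg hβ0 hZ)
  rw [trace_exp_mul_sub hX hY]
  -- Cauchy–Schwarz for the weights `overlap * exp(x_i)`: the first moment is bounded by the second.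
  have hcs := Finset.sum_mul_sq_le_sq_mul_sq (Finset.univ : Finset (ι × ι))
    (fun p => Real.sqrt (overlap hX hY p.1 p.2 * Real.exp (hX.eigenvalues p.1)))
    (fun p => Real.sqrt (overlap hX hY p.1 p.2 * Real.exp (hX.eigenvalues p.1)) *
      (hY.eigenvalues p.2 - hX.eigenvalues p.1))
  have hn : ∀ i j, 0 ≤ overlap hX hY i j * Real.exp (hX.eigenvalues i) := fun i j =>
    mul_nonneg (overlap_nonneg _ _ _ _) (Real.exp_pos _).le
  simp only [← mul_assoc, Real.mul_self_sqrt (hn _ _), Real.sq_sqrt (hn _ _), mul_pow,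
    Fintype.sum_prod_type] at hcs
  rw [← partitionFn_eq_left hX hY] at hcs
  simp only [← mul_assoc] at e1 ⊢
  nlinarith [mul_le_mul_of_nonneg_left e1 hZ]

/-- The second-order expansion of the free energy, with an explicit remainder. -/
lemma log_partitionFn_le_of_le_one [Nonempty ι] (hX : X.IsHermitian) (hY : Y.IsHermitian) {β : ℝ}
    (hβ : ‖Matrix.toEuclideanCLM (𝕜 := ℂ) (Y - X)‖ ≤ β) (hβ1 : β ≤ 1) :
    Real.log (partitionFn Y) ≤ Real.log (partitionFn X) +
      (NormedSpace.exp X * (Y - X)).trace.re / partitionFn X + β ^ 2 / 2 + β ^ 3 / 3 := by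
  have hβ0 : 0 ≤ β := (norm_nonneg _).trans hβ
  have hZX := partitionFn_pos hX
  have hZY := partitionFn_pos hY
  have h1 := partitionFn_le hX hY hβ
  have h2 := (abs_le.1 (abs_trace_exp_mul_sub_le hX hY hβ)).2
  set m := (NormedSpace.exp X * (Y - X)).trace.re / partitionFn X with hm
  have hM : (NormedSpace.exp X * (Y - X)).trace.re = m * partitionFn X := by
    rw [hm]; field_simp
  set r := partitionFn Y / partitionFn X with hr
  have hR : partitionFn Y = r * partitionFn X := by
    rw [hr]; field_simp
  have hr0 : 0 < r := div_pos hZY hZX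
  rw [hM] at h1 h2
  rw [hR] at h1
  have h2' : m ≤ β := le_of_mul_le_mul_right h2 hZX
  have h1' : r ≤ 1 + m + β ^ 2 * (2 + r) / 6 := by
    refine le_of_mul_le_mul_right ?_ hZX
    linarith
  have h3 : Real.log (partitionFn Y) = Real.log (partitionFn X) + Real.log r := by
    rw [hR, Real.log_mul hr0.ne' hZX.ne', add_comm]
  have h4 := Real.log_le_sub_one_of_pos hr0
  -- An a priori bound on `r`, fed back into `β² (2 + r) / 6 = β² / 2 + β² (r - 1) / 6` to make the
  -- last term at most `β³ / 3`.
  have h5 : r - 1 ≤ 2 * β := by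
    by_contra! hlt
    have hb2 : β ^ 2 ≤ β := by nlinarith
    have hq : β ^ 2 * (r - 1) ≤ 1 * (r - 1) :=
      mul_le_mul_of_nonneg_right (by linarith) (by linarith)
    linarith
  nlinarith [mul_le_mul_of_nonneg_left h5 (sq_nonneg β)]


/-- The error terms of a telescoped quadratic bound vanish as the steps shrink. -/
lemma le_quadratic_of_local {φ ψ : ℝ → ℝ} {c K δ : ℝ} (hδ : 0 < δ)
    (hup : ∀ t h, |h| ≤ δ → φ (t + h) ≤ φ t + h * ψ t + c * h ^ 2 / 2 + K * |h| ^ 3) :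
    φ 1 ≤ φ 0 + ψ 0 + c / 2 := by
  have key : ∀ N : ℕ, 0 < N → (1 : ℝ) / N ≤ δ → φ 1 ≤ φ 0 + ψ 0 + (c + 2 * K * (1 / N)) / 2 := by
    intro N hN hNδ
    set h : ℝ := 1 / N with hh
    have hN' : (0 : ℝ) < N := by exact_mod_cast hN
    have hpos : 0 < h := by positivity
    have hab : |h| = h := abs_of_pos hpos
    -- Adding the bounds for the step from `t` to `t + h` and for the step back cancels `φ`. This
    -- controls the growth of `ψ` without knowing that it is the derivative of `φ`.
    have hψ : ∀ t, ψ (t + h) ≤ ψ t + (c * h + 2 * K * h ^ 2) := by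
      intro t
      have h1 := hup t h (by rw [hab]; exact hNδ)
      have h2 := hup (t + h) (-h) (by rw [abs_neg, hab]; exact hNδ)
      rw [abs_neg, hab] at h2
      rw [hab] at h1
      have h3 : t + h + -h = t := by ring
      rw [h3] at h2
      refine le_of_mul_le_mul_left ?_ hpos
      linarith
    have hψk : ∀ k : ℕ, ψ (k * h) ≤ ψ 0 + k * (c * h + 2 * K * h ^ 2) := by
      intro k
      induction k with
      | zero => simp
      | succ k ih =>
        have h1 := hψ (k * h)
        have h2 : ((k + 1 : ℕ) : ℝ) * h = k * h + h := by push_cast; ring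
        rw [h2]
        push_cast
        linarith
    have hφk : ∀ k : ℕ, φ (k * h) ≤ φ 0 + k * h * ψ 0 + (k * h) ^ 2 * (c + 2 * K * h) / 2 := by
      intro k
      induction k with
      | zero => simp
      | succ k ih =>
        have h1 := hup (k * h) h (by rw [hab]; exact hNδ)
        rw [hab] at h1
        have h2 : ((k + 1 : ℕ) : ℝ) * h = k * h + h := by push_cast; ring
        have h3 := mul_le_mul_of_nonneg_left (hψk k) hpos.le
        rw [h2]
        nlinarith
    have h1 := hφk N
    have h2 : (N : ℝ) * h = 1 := by rw [hh]; field_simp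
    rw [h2] at h1
    linarith
  have hlim : Filter.Tendsto (fun N : ℕ => φ 0 + ψ 0 + (c + 2 * K * (1 / (N : ℝ))) / 2)
      Filter.atTop (nhds (φ 0 + ψ 0 + (c + 2 * K * 0) / 2)) := by
    have h := tendsto_one_div_atTop_nhds_zero_nat (𝕜 := ℝ)
    exact tendsto_const_nhds.add
      ((tendsto_const_nhds.add (tendsto_const_nhds.mul h)).div_const 2)
  rw [mul_zero, add_zero] at hlim
  refine ge_of_tendsto hlim ?_
  have h0 := (tendsto_one_div_atTop_nhds_zero_nat (𝕜 := ℝ)).eventually (ge_mem_nhds hδ)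
  filter_upwards [h0, Filter.eventually_gt_atTop 0] with N hN1 hN2
  exact key N hN2 hN1

/-- The free energy `log Tr[exp X]` is smooth: its second derivative in a direction `B` is at most
the squared spectral norm of `B`. -/
lemma log_partitionFn_le [Nonempty ι] (hX : X.IsHermitian) {B : Matrix ι ι ℂ} (hB : B.IsHermitian)
    {β : ℝ} (hβ : ‖Matrix.toEuclideanCLM (𝕜 := ℂ) B‖ ≤ β) :
    Real.log (partitionFn (X + B)) ≤ Real.log (partitionFn X) +
      (NormedSpace.exp X * B).trace.re / partitionFn X + β ^ 2 / 2 := by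
  have hβ0 : 0 ≤ β := (norm_nonneg _).trans hβ
  have hherm : ∀ t : ℝ, (X + (t : ℂ) • B).IsHermitian := fun t =>
    hX.add (by rw [Matrix.IsHermitian, Matrix.conjTranspose_smul, hB.eq]; simp)
  -- The radius `1 / (β + 1)` keeps the perturbation norm `|s| β` at most `1`, as the local
  -- expansion requires; its cubic remainder supplies `K = β³ / 3`.
  have h := le_quadratic_of_local (φ := fun t => Real.log (partitionFn (X + (t : ℂ) • B)))
    (ψ := fun t => (NormedSpace.exp (X + (t : ℂ) • B) * B).trace.re /
      partitionFn (X + (t : ℂ) • B)) (c := β ^ 2) (K := β ^ 3 / 3) (δ := 1 / (β + 1))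
    (by positivity) ?_
  · simpa using h
  intro t s hs
  have hsub : (X + ((t + s : ℝ) : ℂ) • B) - (X + (t : ℂ) • B) = (s : ℂ) • B := by
    push_cast
    rw [add_smul]
    abel
  have hle : |s| * β ≤ 1 := by
    have : |s| * (β + 1) ≤ 1 := by
      have h1 := mul_le_mul_of_nonneg_right hs (by positivity : 0 ≤ β + 1)
      rwa [one_div, inv_mul_cancel₀ (by positivity)] at h1
    nlinarith [abs_nonneg s]
  have h := log_partitionFn_le_of_le_one (hherm t) (hherm (t + s)) (β := |s| * β)
    (by
      rw [hsub, map_smul, norm_smul, Complex.norm_real, Real.norm_eq_abs]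
      exact mul_le_mul_of_nonneg_left hβ (abs_nonneg s)) hle
  rw [hsub, Matrix.mul_smul, Matrix.trace_smul, smul_eq_mul, Complex.re_ofReal_mul] at h
  refine h.trans (le_of_eq ?_)
  rw [mul_pow, sq_abs]
  ring

end Perturbation

/-! ### The loss: gradient, smoothness, Polyak–Łojasiewicz -/

section Loss

variable {n m : ℕ} {H : Fin m → Op n}

lemma isHermitian_hamiltonian (hH : ∀ i, (H i).IsHermitian) (θ : EuclideanSpace ℝ (Fin m)) :
    (hamiltonian H θ).IsHermitian := by
  rw [Matrix.IsHermitian, hamiltonian, Matrix.conjTranspose_sum]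
  refine Finset.sum_congr rfl fun i _ => ?_
  rw [Matrix.conjTranspose_smul, (hH i).eq]
  simp

lemma hamiltonian_add (θ v : EuclideanSpace ℝ (Fin m)) :
    hamiltonian H (θ + v) = hamiltonian H θ + hamiltonian H v := by
  simp [hamiltonian, add_smul, Finset.sum_add_distrib]

lemma hamiltonian_smul_single (i : Fin m) (s : ℝ) :
    hamiltonian H (s • EuclideanSpace.single i 1) = (s : ℂ) • H i := by
  rw [hamiltonian, Finset.sum_eq_single i]
  · simp
  · intro j _ hj; simp [hj]
  · simp

/-- The triangle inequality gives the `ℓ¹` norm of `v`, and Cauchy–Schwarz costs `√m`. Squared, this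
is the smoothness constant `m`. -/
lemma norm_hamiltonian_le (hH1 : ∀ i, specNorm (H i) ≤ 1) (v : EuclideanSpace ℝ (Fin m)) :
    ‖Matrix.toEuclideanCLM (𝕜 := ℂ) (hamiltonian H v)‖ ≤ Real.sqrt m * ‖v‖ := by
  have h1 : ‖Matrix.toEuclideanCLM (𝕜 := ℂ) (hamiltonian H v)‖ ≤ ∑ i, |v i| := by
    rw [hamiltonian, map_sum]
    refine (norm_sum_le _ _).trans (Finset.sum_le_sum fun i _ => ?_)
    rw [map_smul, norm_smul, Complex.norm_real, Real.norm_eq_abs]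
    exact mul_le_of_le_one_right (abs_nonneg _) (hH1 i)
  refine h1.trans ?_
  rw [EuclideanSpace.norm_eq, ← Real.sqrt_mul (by positivity)]
  refine Real.le_sqrt_of_sq_le ?_
  have := sq_sum_le_card_mul_sum_sq (s := (Finset.univ : Finset (Fin m))) (f := fun i => |v i|)
  simpa using this

lemma expVal_gibbs (hH : ∀ i, (H i).IsHermitian) (A : Op n) (θ : EuclideanSpace ℝ (Fin m)) :
    expVal A (gibbs H θ) = (NormedSpace.exp (hamiltonian H θ) * A).trace.re /
      partitionFn (hamiltonian H θ) := by
  rw [expVal, gibbs, trace_exp_eq (isHermitian_hamiltonian hH θ), Matrix.smul_mul,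
    Matrix.trace_smul, smul_eq_mul, ← Complex.ofReal_inv, Complex.re_ofReal_mul]
  ring

/-- Absorbing the normalisation into the exponent lets `log ρ_θ` be read off as `H_θ - log Z`. -/
lemma gibbs_eq_exp (hH : ∀ i, (H i).IsHermitian) (θ : EuclideanSpace ℝ (Fin m)) :
    gibbs H θ = NormedSpace.exp (hamiltonian H θ +
      ((-Real.log (partitionFn (hamiltonian H θ)) : ℝ) : ℂ) • (1 : Op n)) := by
  have hZ := partitionFn_pos (isHermitian_hamiltonian hH θ)
  rw [Matrix.exp_add_of_commute _ _ (by
    rw [commute_iff_eq, Matrix.mul_smul, Matrix.smul_mul, Matrix.mul_one, Matrix.one_mul])]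
  have h1 : NormedSpace.exp (((-Real.log (partitionFn (hamiltonian H θ)) : ℝ) : ℂ) • (1 : Op n)) =
      ((partitionFn (hamiltonian H θ) : ℂ))⁻¹ • (1 : Op n) := by
    rw [Matrix.smul_one_eq_diagonal, Matrix.exp_diagonal, Matrix.smul_one_eq_diagonal]
    congr 1
    ext i
    rw [Pi.coe_exp, ← Complex.exp_eq_exp_ℂ, ← Complex.ofReal_exp, Real.exp_neg, Real.exp_log hZ]
    push_cast
    rfl
  rw [h1, gibbs, trace_exp_eq (isHermitian_hamiltonian hH θ)]
  simp

open scoped Matrix.Norms.L2Operator in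
lemma cfc_log_exp {A : Op n} (hA : A.IsHermitian) : cfc Real.log (NormedSpace.exp A) = A := 
  CFC.log_exp A hA

lemma isDensity_gibbs (hH : ∀ i, (H i).IsHermitian) (θ : EuclideanSpace ℝ (Fin m)) :
    IsDensity (gibbs H θ) := by
  have hX := isHermitian_hamiltonian hH θ
  have hZ := partitionFn_pos hX
  constructor
  · rw [gibbs, trace_exp_eq hX, ← specFn_exp hX, ← Complex.ofReal_inv]
    refine Matrix.PosSemidef.smul ?_ (by
      rw [Complex.zero_le_real]; positivity)
    refine Matrix.PosSemidef.mul_mul_conjTranspose_same (Matrix.PosSemidef.diagonal ?_) _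
    intro i
    simp only [Pi.zero_apply, Complex.zero_le_real]
    positivity
  · rw [gibbs, Matrix.trace_smul, trace_exp_eq hX, smul_eq_mul]
    exact inv_mul_cancel₀ (by exact_mod_cast hZ.ne')

/-- The loss is the free energy minus a linear functional, up to a constant. -/
lemma loss_eq (hH : ∀ i, (H i).IsHermitian) {η : Op n} (hη : IsDensity η)
    (θ : EuclideanSpace ℝ (Fin m)) :
    loss H η θ = (Matrix.trace (η * cfc Real.log η)).re - ∑ i, θ i * expVal (H i) η +
      Real.log (partitionFn (hamiltonian H θ)) := by
  have hlog : cfc Real.log (gibbs H θ) = hamiltonian H θ +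
      ((-Real.log (partitionFn (hamiltonian H θ)) : ℝ) : ℂ) • (1 : Op n) := by
    rw [gibbs_eq_exp hH θ]
    refine cfc_log_exp ((isHermitian_hamiltonian hH θ).add ?_)
    rw [Matrix.IsHermitian, Matrix.conjTranspose_smul]
    simp
  have hham : (η * hamiltonian H θ).trace.re = ∑ i, θ i * expVal (H i) η := by
    simp [hamiltonian, Finset.mul_sum, Matrix.trace_sum, Matrix.trace_smul, expVal]
  rw [loss, relEntropy, hlog, Matrix.mul_add, Matrix.trace_add, Matrix.mul_smul, Matrix.mul_one,
    Matrix.trace_smul, hη.2, Complex.sub_re, Complex.add_re, hham]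
  simp
  ring

/-- The coordinates `⟨H i⟩_{ρ_θ} - ⟨H i⟩_η` of the gradient of the loss. -/
noncomputable def lossGrad (H : Fin m → Op n) (η : Op n) (θ : EuclideanSpace ℝ (Fin m)) :
    EuclideanSpace ℝ (Fin m) :=
  WithLp.toLp 2 fun i => expVal (H i) (gibbs H θ) - expVal (H i) η

lemma sum_mul_expVal_gibbs (hH : ∀ i, (H i).IsHermitian) (θ v : EuclideanSpace ℝ (Fin m)) :
    ∑ i, v i * expVal (H i) (gibbs H θ) =
      (NormedSpace.exp (hamiltonian H θ) * hamiltonian H v).trace.re /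
        partitionFn (hamiltonian H θ) := by
  simp only [expVal_gibbs hH]
  have h : (NormedSpace.exp (hamiltonian H θ) * hamiltonian H v).trace.re =
      ∑ i, v i * (NormedSpace.exp (hamiltonian H θ) * H i).trace.re := by
    conv_lhs => rw [hamiltonian.eq_def H v]
    simp [Finset.mul_sum, Matrix.trace_sum, Matrix.trace_smul]
  rw [h, Finset.sum_div]
  simp only [mul_div_assoc]

lemma inner_lossGrad (H : Fin m → Op n) (η : Op n) (θ v : EuclideanSpace ℝ (Fin m)) :
    inner ℝ (lossGrad H η θ) v =
      ∑ i, v i * expVal (H i) (gibbs H θ) - ∑ i, v i * expVal (H i) η := by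
  rw [PiLp.inner_apply, ← Finset.sum_sub_distrib]
  refine Finset.sum_congr rfl fun i _ => ?_
  simp [lossGrad]
  ring

variable (hH : ∀ i, (H i).IsHermitian) {η : Op n} (hη : IsDensity η)
include hH hη

lemma loss_add_ge (θ v : EuclideanSpace ℝ (Fin m)) :
    loss H η θ + inner ℝ (lossGrad H η θ) v ≤ loss H η (θ + v) := by
  have h := log_partitionFn_ge (isHermitian_hamiltonian hH θ) (isHermitian_hamiltonian hH (θ + v))
  rw [hamiltonian_add, add_sub_cancel_left, ← sum_mul_expVal_gibbs hH, ← hamiltonian_add] at h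
  rw [loss_eq hH hη, loss_eq hH hη, inner_lossGrad]
  simp only [PiLp.add_apply, add_mul, Finset.sum_add_distrib]
  linarith

/-- Kept in terms of the operator norm of `H_v`: along a coordinate axis this norm is at most `|v
i|`, without the factor `√m`. -/
lemma loss_add_le_of_norm_le (θ v : EuclideanSpace ℝ (Fin m)) {β : ℝ}
    (hβ : ‖Matrix.toEuclideanCLM (𝕜 := ℂ) (hamiltonian H v)‖ ≤ β) :
    loss H η (θ + v) ≤ loss H η θ + inner ℝ (lossGrad H η θ) v + β ^ 2 / 2 := by
  have h := log_partitionFn_le (isHermitian_hamiltonian hH θ) (isHermitian_hamiltonian hH v) hβ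
  rw [← sum_mul_expVal_gibbs hH, ← hamiltonian_add] at h
  rw [loss_eq hH hη, loss_eq hH hη, inner_lossGrad]
  simp only [PiLp.add_apply, add_mul, Finset.sum_add_distrib]
  linarith

lemma loss_add_le (hH1 : ∀ i, specNorm (H i) ≤ 1) (θ v : EuclideanSpace ℝ (Fin m)) :
    loss H η (θ + v) ≤ loss H η θ + inner ℝ (lossGrad H η θ) v + m / 2 * ‖v‖ ^ 2 := by
  have h := loss_add_le_of_norm_le hH hη θ v (norm_hamiltonian_le hH1 v)
  rw [mul_pow, Real.sq_sqrt (Nat.cast_nonneg m)] at h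
  linarith

/-- The loss lies between an affine function and that function plus `m/2 ‖v‖²`, which forces
differentiability; the matrix exponential is never differentiated. -/
lemma hasGradientAt_loss (hH1 : ∀ i, specNorm (H i) ≤ 1) (θ : EuclideanSpace ℝ (Fin m)) :
    HasGradientAt (loss H η) (lossGrad H η θ) θ := by
  rw [hasGradientAt_iff_isLittleO]
  have hO : (fun x' => loss H η x' - loss H η θ - inner ℝ (lossGrad H η θ) (x' - θ)) =O[nhds θ]
      fun x' => ‖x' - θ‖ ^ 2 := by
    refine Asymptotics.IsBigO.of_bound (m / 2) (Filter.Eventually.of_forall fun x' => ?_)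
    have h1 := loss_add_ge hH hη θ (x' - θ)
    have h2 := loss_add_le hH hη hH1 θ (x' - θ)
    rw [add_sub_cancel] at h1 h2
    rw [Real.norm_eq_abs, Real.norm_eq_abs, abs_of_nonneg (by linarith), abs_of_nonneg (by positivity)]
    linarith
  refine hO.trans_isLittleO ?_
  have := (Asymptotics.isLittleO_pow_sub_sub θ (one_lt_two))
  exact this

lemma gradient_loss (hH1 : ∀ i, specNorm (H i) ≤ 1) (θ : EuclideanSpace ℝ (Fin m)) :
    gradient (loss H η) θ = lossGrad H η θ :=
  (hasGradientAt_loss hH hη hH1 θ).gradient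

/-- A step of length `g` against coordinate `i` lowers the loss by at least `g² / 2`, and cannot go
below the minimum over the whole space. -/
lemma sq_lossGrad_le (hH1 : ∀ i, specNorm (H i) ≤ 1) {θopt : EuclideanSpace ℝ (Fin m)}
    (hopt : ∀ θ, loss H η θopt ≤ loss H η θ) (θ : EuclideanSpace ℝ (Fin m)) (i : Fin m) :
    lossGrad H η θ i ^ 2 ≤ 2 * (loss H η θ - loss H η θopt) := by
  set g := lossGrad H η θ i with hg
  have h := loss_add_le_of_norm_le hH hη θ ((-g) • EuclideanSpace.single i 1) (β := |g|) (by
    rw [hamiltonian_smul_single, map_smul, norm_smul, Complex.norm_real, Real.norm_eq_abs, abs_neg]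
    exact mul_le_of_le_one_right (abs_nonneg _) (hH1 i))
  have h2 : inner ℝ (lossGrad H η θ) ((-g) • EuclideanSpace.single i (1 : ℝ)) = -g * g := by
    rw [inner_smul_right, EuclideanSpace.inner_single_right]
    simp [hg]
  rw [h2, sq_abs] at h
  linarith [hopt (θ + (-g) • EuclideanSpace.single i 1)]

/-- The Polyak–Łojasiewicz inequality. -/
lemma polyak_lojasiewicz {Θ : Set (EuclideanSpace ℝ (Fin m))} {α : ℝ} (hα : 0 < α)
    (hsc : StrongConvexOn Θ α (loss H η)) {θ θopt : EuclideanSpace ℝ (Fin m)} (hθ : θ ∈ Θ)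
    (hopt : θopt ∈ Θ) :
    2 * α * (loss H η θ - loss H η θopt) ≤ ‖lossGrad H η θ‖ ^ 2 := by
  set w := θopt - θ with hw
  -- Strong convexity on the segment towards `θopt`, compared with the affine lower bound at `θ`;
  -- letting `s → 0` gives the first-order form.
  have key : ∀ s : ℝ, 0 < s → s ≤ 1 → inner ℝ (lossGrad H η θ) w ≤
      loss H η θopt - loss H η θ - (1 - s) * (α / 2 * ‖w‖ ^ 2) := by
    intro s hs0 hs1
    have h1 := hsc.2 hθ hopt (sub_nonneg.2 hs1) hs0.le (by ring)
    have h2 := loss_add_ge hH hη θ (s • w)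
    have h3 : (1 - s) • θ + s • θopt = θ + s • w := by
      rw [hw, smul_sub, sub_smul, one_smul]; abel
    rw [h3] at h1
    rw [inner_smul_right] at h2
    have h4 : ‖θ - θopt‖ = ‖w‖ := by rw [hw, norm_sub_rev]
    simp only [smul_eq_mul, h4] at h1
    refine le_of_mul_le_mul_left ?_ hs0
    linarith
  have hlim : inner ℝ (lossGrad H η θ) w ≤ loss H η θopt - loss H η θ - α / 2 * ‖w‖ ^ 2 := by
    have ht : Filter.Tendsto (fun s : ℝ => loss H η θopt - loss H η θ - (1 - s) * (α / 2 * ‖w‖ ^ 2))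
        (nhdsWithin 0 (Set.Ioi 0))
        (nhds (loss H η θopt - loss H η θ - (1 - 0) * (α / 2 * ‖w‖ ^ 2))) :=
      (Continuous.tendsto (by fun_prop) 0).mono_left nhdsWithin_le_nhds
    rw [sub_zero, one_mul] at ht
    refine ge_of_tendsto ht ?_
    filter_upwards [Ioc_mem_nhdsGT (zero_lt_one' ℝ)] with s hs
    exact key s hs.1 hs.2
  have hcs := abs_le.1 (abs_real_inner_le_norm (lossGrad H η θ) w)
  -- Optimising over `‖w‖`: `2α (f - f_opt) + α² ‖w‖² ≤ 2α ‖g‖ ‖w‖ ≤ ‖g‖² + α² ‖w‖²`.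
  nlinarith [sq_nonneg (‖lossGrad H η θ‖ - α * ‖w‖), hcs.1]

/-- The modulus of strong convexity is at most the smoothness constant, unless the domain is a
single point. -/
lemma strongConvexity_le (hH1 : ∀ i, specNorm (H i) ≤ 1) {Θ : Set (EuclideanSpace ℝ (Fin m))}
    {α : ℝ} (hsc : StrongConvexOn Θ α (loss H η)) {θ θopt : EuclideanSpace ℝ (Fin m)} (hθ : θ ∈ Θ)
    (hoptΘ : θopt ∈ Θ) (hopt : ∀ θ, loss H η θopt ≤ loss H η θ) (hne : θ ≠ θopt) : α ≤ m := by
  have hg : lossGrad H η θopt = 0 := by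
    ext i
    have h := sq_lossGrad_le hH hη hH1 hopt θopt i
    rw [sub_self, mul_zero] at h
    exact pow_eq_zero_iff two_ne_zero |>.1 (le_antisymm h (sq_nonneg _))
  have h1 := loss_add_le hH hη hH1 θopt (θ - θopt)
  rw [hg, inner_zero_left, add_sub_cancel] at h1
  have hd : 0 < ‖θ - θopt‖ ^ 2 := by
    have := norm_pos_iff.2 (sub_ne_zero.2 hne)
    positivity
  -- Here `s → 0` gives quadratic growth `α/2 ‖θ - θopt‖²` from the minimum, against at most `m/2 ‖θ
  -- - θopt‖²` from smoothness.
  have key : ∀ s : ℝ, 0 < s → s ≤ 1 → (1 - s) * (α / 2 * ‖θ - θopt‖ ^ 2) ≤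
      loss H η θ - loss H η θopt := by
    intro s hs0 hs1
    have h2 := hsc.2 hθ hoptΘ hs0.le (sub_nonneg.2 hs1) (by ring)
    have h3 := hopt (s • θ + (1 - s) • θopt)
    simp only [smul_eq_mul] at h2
    refine le_of_mul_le_mul_left ?_ hs0
    linarith
  have hlim : α / 2 * ‖θ - θopt‖ ^ 2 ≤ loss H η θ - loss H η θopt := by
    have ht : Filter.Tendsto (fun s : ℝ => (1 - s) * (α / 2 * ‖θ - θopt‖ ^ 2))
        (nhdsWithin 0 (Set.Ioi 0)) (nhds ((1 - 0) * (α / 2 * ‖θ - θopt‖ ^ 2))) :=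
      (Continuous.tendsto (by fun_prop) 0).mono_left nhdsWithin_le_nhds
    rw [sub_zero, one_mul] at ht
    refine le_of_tendsto ht ?_
    filter_upwards [Ioc_mem_nhdsGT (zero_lt_one' ℝ)] with s hs
    exact key s hs.1 hs.2
  have : α / 2 * ‖θ - θopt‖ ^ 2 ≤ m / 2 * ‖θ - θopt‖ ^ 2 := by linarith
  linarith [le_of_mul_le_mul_right this hd]

end Loss

/-! ### The Khaled–Richtárik step-size recursion -/

section StepSizes

lemma stepSize_nonneg {a b : ℝ} (ha : 0 < a) (hb : 0 < b) (T t : ℕ) : 0 ≤ stepSize a b T t := by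
  unfold stepSize
  split_ifs with h
  · positivity
  · push Not at h
    have h2 : (⌈(T : ℝ) / 2⌉₊ : ℝ) ≤ t := by exact_mod_cast h.2
    have : 0 < 2 * b / a := by positivity
    have : 0 < 2 * b / a + (t : ℝ) - (⌈(T : ℝ) / 2⌉₊ : ℝ) := by linarith
    positivity

lemma stepSize_le {a b : ℝ} (ha : 0 < a) (hb : 0 < b) (T t : ℕ) : stepSize a b T t ≤ 1 / b := by
  unfold stepSize
  split_ifs with h
  · exact le_rfl
  · push Not at h
    have h2 : (⌈(T : ℝ) / 2⌉₊ : ℝ) ≤ t := by exact_mod_cast h.2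
    have h3 : 2 * b ≤ a * (2 * b / a + (t : ℝ) - (⌈(T : ℝ) / 2⌉₊ : ℝ)) := by
      have : a * (2 * b / a) = 2 * b := by field_simp
      nlinarith
    calc _ ≤ 2 / (2 * b) := div_le_div_of_nonneg_left (by norm_num) (by positivity) h3
      _ = 1 / b := by field_simp

/-- A constant step contracts geometrically down to a noise floor. -/
lemma le_of_constant_step {a b c : ℝ} (ha : 0 < a) (hb : 0 < b) (hab : a ≤ b) {d : ℕ → ℝ} {k : ℕ}
    (hd0 : 0 ≤ d 0) (hc : 0 ≤ c)
    (hrec : ∀ t < k, d (t + 1) ≤ (1 - a * (1 / b)) * d t + c * (1 / b) ^ 2) :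
    d k ≤ Real.exp (-(a * k / b)) * d 0 + c / (a * b) := by
  induction k with
  | zero => simp; positivity
  | succ k ih =>
    have h1 := ih fun t ht => hrec t (by omega)
    have h2 := hrec k (by omega)
    have hq : 0 ≤ 1 - a * (1 / b) := by
      rw [mul_one_div, sub_nonneg, div_le_one hb]; exact hab
    have h3 := mul_le_mul_of_nonneg_left h1 hq
    have h4 : 1 - a * (1 / b) ≤ Real.exp (-(a / b)) := by
      have := Real.add_one_le_exp (-(a / b))
      rw [mul_one_div]
      linarith
    have h5 : Real.exp (-(a * (k + 1 : ℕ) / b)) = Real.exp (-(a / b)) * Real.exp (-(a * k / b)) := by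
      rw [← Real.exp_add]
      congr 1
      push_cast
      field_simp
      ring
    have h6 : (1 - a * (1 / b)) * (Real.exp (-(a * k / b)) * d 0) ≤
        Real.exp (-(a / b)) * (Real.exp (-(a * k / b)) * d 0) :=
      mul_le_mul_of_nonneg_right h4 (mul_nonneg (Real.exp_pos _).le hd0)
    -- The noise floor `c / (a b)` is the fixed point of the recursion.
    have h7 : (1 - a * (1 / b)) * (c / (a * b)) + c * (1 / b) ^ 2 = c / (a * b) := by
      field_simp
      ring
    rw [h5]
    nlinarith

/-- The Khaled–Richtárik recursion. -/
lemma le_of_stepSize_recursion {a b c : ℝ} (ha : 0 < a) (hb : 0 < b) (hab : 4 * a ≤ b) {d : ℕ → ℝ}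
    {T : ℕ} (hT : 0 < T) (hd : ∀ t, 0 ≤ d t) (hc : 0 ≤ c)
    (hrec : ∀ t < T, d (t + 1) ≤ (1 - a * stepSize a b T t) * d t + c * stepSize a b T t ^ 2) :
    d T ≤ Real.exp (-(a * T / (2 * b))) * d 0 + 8 * c / (a ^ 2 * T) := by
  have hT' : (0 : ℝ) < T := by exact_mod_cast hT
  by_cases hcase : (T : ℝ) ≤ b / a
  · have h1 := le_of_constant_step (k := T) ha hb (by linarith) (hd 0) hc (fun t ht => by
      have := hrec t ht
      rwa [stepSize, if_pos (Or.inl hcase)] at this)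
    have h2 : Real.exp (-(a * T / b)) ≤ Real.exp (-(a * T / (2 * b))) := by
      apply Real.exp_le_exp.2
      have : a * T / (2 * b) ≤ a * T / b :=
        div_le_div_of_nonneg_left (by positivity) hb (by linarith)
      linarith
    have h3 : c / (a * b) ≤ 8 * c / (a ^ 2 * T) := by
      have h4 : (T : ℝ) * a ≤ b := by rwa [le_div_iff₀ ha] at hcase
      calc c / (a * b) ≤ c / (a ^ 2 * T) :=
            div_le_div_of_nonneg_left hc (by positivity) (by nlinarith)
        _ ≤ _ := div_le_div_of_nonneg_right (by linarith) (by positivity)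
    have h4 := mul_le_mul_of_nonneg_right h2 (hd 0)
    linarith
  · set k := ⌈(T : ℝ) / 2⌉₊ with hk
    set s := 2 * b / a with hs
    have hs8 : 8 ≤ s := by rw [hs, le_div_iff₀ ha]; linarith
    have hkT : k ≤ T := Nat.ceil_le.2 (by linarith)
    have hk1 : (T : ℝ) / 2 ≤ k := Nat.le_ceil _
    have hk2 : (k : ℝ) < T / 2 + 1 := Nat.ceil_lt_add_one (by positivity)
    have h1 := le_of_constant_step (k := k) ha hb (by linarith) (hd 0) hc (fun t ht => by
      have := hrec t (by omega)
      rwa [stepSize, if_pos (Or.inr ht)] at this)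
    -- With `x = s + j` the step is `2 / (a x)`, so the contraction times `x²` is `x² - 2x ≤ (x -
    -- 1)²`. These weights telescope, and each step adds exactly `4c / a²`.
    have h2 : ∀ j : ℕ, k + j ≤ T →
        (s + j - 1) ^ 2 * d (k + j) ≤ (s - 1) ^ 2 * d k + 4 * c / a ^ 2 * j := by
      intro j
      induction j with
      | zero => simp
      | succ j ih =>
        intro hj
        have ih' := ih (by omega)
        have hr := hrec (k + j) (by omega)
        rw [stepSize, if_neg (by push Not; exact ⟨not_le.1 hcase, by omega⟩)] at hr
        set x := s + (j : ℝ) with hx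
        have hx8 : 8 ≤ x := by have := Nat.cast_nonneg (α := ℝ) j; linarith
        have e1 : s + ((k + j : ℕ) : ℝ) - (k : ℝ) = x := by push_cast; ring
        rw [← hk, e1] at hr
        have e2 : s + ((j + 1 : ℕ) : ℝ) - 1 = x := by push_cast; ring
        rw [e2, ← add_assoc]
        have h3 := mul_le_mul_of_nonneg_left hr (sq_nonneg x)
        have h4 : x ^ 2 * ((1 - a * (2 / (a * x))) * d (k + j) + c * (2 / (a * x)) ^ 2) =
            (x ^ 2 - 2 * x) * d (k + j) + 4 * c / a ^ 2 := by
          field_simp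
          ring
        have h5 : (x ^ 2 - 2 * x) * d (k + j) ≤ (x - 1) ^ 2 * d (k + j) :=
          mul_le_mul_of_nonneg_right (by nlinarith) (hd _)
        push_cast
        linarith
    obtain ⟨J, hJ⟩ := Nat.exists_eq_add_of_le hkT
    have h3 := h2 J hJ.ge
    rw [← hJ] at h3
    have hJ' : (J : ℝ) = T - k := by rw [hJ]; push_cast; ring
    -- `J > T/2 - 1`, and the offset `s ≥ 8`, which comes from `4a ≤ b`, makes up for the lost
    -- units.
    have hy : (T : ℝ) / 2 ≤ s + J - 1 := by linarith
    set y := s + (J : ℝ) - 1 with hyd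
    have hy0 : 0 < y := by linarith
    have hJ0 := Nat.cast_nonneg (α := ℝ) J
    have h4 : Real.exp (-(a * k / b)) ≤ Real.exp (-(a * T / (2 * b))) := by
      apply Real.exp_le_exp.2
      have : a * T / (2 * b) ≤ a * k / b := by
        rw [div_le_div_iff₀ (by positivity) hb]
        have := mul_le_mul_of_nonneg_left hk1 (mul_pos ha hb).le
        linarith
      linarith
    set e := Real.exp (-(a * T / (2 * b))) with he
    have h5 : d k ≤ e * d 0 + c / (a * b) :=
      h1.trans (by linarith [mul_le_mul_of_nonneg_right h4 (hd 0)])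
    have h6 : c / (a * b) = 2 * c / (a ^ 2 * s) := by
      rw [hs]; field_simp
    -- The floor left by the constant phase costs no more than `s - 1` further decaying steps, so
    -- the total noise is `4c / a²` times `s - 1 + J = y`.
    have h7 : (s - 1) ^ 2 * (2 * c / (a ^ 2 * s)) ≤ 4 * c / a ^ 2 * (s - 1) := by
      have : (s - 1) ^ 2 * (2 * c / (a ^ 2 * s)) = 4 * c / a ^ 2 * (s - 1) * ((s - 1) / (2 * s)) := by
        field_simp
        ring
      rw [this]
      refine mul_le_of_le_one_right (mul_nonneg (by positivity) (by linarith)) ?_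
      rw [div_le_one (by linarith)]
      linarith
    have h8 : (s - 1) ^ 2 * (e * d 0) ≤ y ^ 2 * (e * d 0) := by
      refine mul_le_mul_of_nonneg_right ?_ (mul_nonneg (Real.exp_pos _).le (hd 0))
      exact pow_le_pow_left₀ (by linarith) (by linarith) 2
    have h9 : y ^ 2 * d T ≤ y ^ 2 * (e * d 0 + 4 * c / a ^ 2 / y) := by
      have h10 := mul_le_mul_of_nonneg_left h5 (sq_nonneg (s - 1))
      have h11 : y ^ 2 * (4 * c / a ^ 2 / y) = 4 * c / a ^ 2 * (s - 1) + 4 * c / a ^ 2 * J := by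
        rw [hyd]
        field_simp
        ring
      rw [mul_add, h11]
      rw [h6] at h10
      linarith
    have h10 := le_of_mul_le_mul_left h9 (by positivity)
    have h11 : 4 * c / a ^ 2 / y ≤ 8 * c / (a ^ 2 * T) := by
      calc 4 * c / a ^ 2 / y ≤ 4 * c / a ^ 2 / (T / 2) :=
            div_le_div_of_nonneg_left (by positivity) (by positivity) hy
        _ = _ := by field_simp; ring
    linarith

end StepSizes

/-! ### Second moment of the stochastic gradient -/

section Variance

variable {Ω : Type*} {m mΩ : MeasurableSpace Ω} {μ : Measure Ω} [IsProbabilityMeasure μ]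

lemma integral_mul_eq_integral_condExp_mul (hm : m ≤ mΩ) {X a : Ω → ℝ} (hX : MemLp X 2 μ)
    (ha : MemLp a 2 μ) (ham : StronglyMeasurable[m] a) :
    ∫ ω, X ω * a ω ∂μ = ∫ ω, (μ[X | m]) ω * a ω ∂μ := by
  have h := condExp_mul_of_stronglyMeasurable_right ham (hX.integrable_mul ha)
    (hX.integrable (by norm_num))
  have h2 := integral_condExp (μ := μ) hm (f := X * a)
  rw [integral_congr_ae h] at h2
  exact h2.symm

/-- The second moment of the difference of two conditionally uncorrelated estimates. -/
lemma integral_sq_sub_le (hm : m ≤ mΩ) {X Y a e : Ω → ℝ} (hX : MemLp X 2 μ) (hY : MemLp Y 2 μ)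
    (ha : MemLp a 2 μ) (he : MemLp e 2 μ) (ham : StronglyMeasurable[m] a)
    (hem : StronglyMeasurable[m] e)
    (hunb : μ[fun ω => X ω - Y ω | m] =ᵐ[μ] fun ω => a ω - e ω)
    (hcor : μ[fun ω => X ω * Y ω | m] =ᵐ[μ] fun ω => (μ[X | m]) ω * (μ[Y | m]) ω)
    {κ ξ : ℝ} (hκ : ∫ ω, (X ω - a ω) ^ 2 ∂μ ≤ κ ^ 2) (hξ : ∫ ω, (Y ω - e ω) ^ 2 ∂μ ≤ ξ ^ 2) :
    ∫ ω, (X ω - Y ω) ^ 2 ∂μ ≤ ∫ ω, (a ω - e ω) ^ 2 ∂μ + (κ ^ 2 + ξ ^ 2) := by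
  set p := μ[X | m] with hp
  set q := μ[Y | m] with hq
  have hpL : MemLp p 2 μ := hX.condExp (by norm_num)
  have hqL : MemLp q 2 μ := hY.condExp (by norm_num)
  have hpq : ∀ᵐ ω ∂μ, p ω - q ω = a ω - e ω := by
    have h := condExp_sub (hX.integrable (by norm_num)) (hY.integrable (by norm_num)) m (μ := μ)
    filter_upwards [h, hunb] with ω h1 h2
    rw [← h2]
    exact h1.symm
  have hXY : ∫ ω, X ω * Y ω ∂μ = ∫ ω, p ω * q ω ∂μ := by
    rw [← integral_condExp hm, integral_congr_ae hcor]
  have hXa := integral_mul_eq_integral_condExp_mul hm hX ha ham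
  have hYe := integral_mul_eq_integral_condExp_mul hm hY he hem
  have i1 : ∀ {f g : Ω → ℝ}, MemLp f 2 μ → MemLp g 2 μ → Integrable (fun ω => f ω * g ω) μ :=
    fun hf hg => hf.integrable_mul hg
  have lin : ∀ {f g h : Ω → ℝ} (r t : ℝ), Integrable f μ → Integrable g μ → Integrable h μ →
      ∫ ω, (r * f ω + t * g ω - 2 * h ω) ∂μ =
        r * ∫ ω, f ω ∂μ + t * ∫ ω, g ω ∂μ - 2 * ∫ ω, h ω ∂μ := by
    intro f g h r t hf hg hh
    have hfg : Integrable (fun ω => r * f ω + t * g ω) μ := (hf.const_mul r).add (hg.const_mul t)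
    rw [integral_sub hfg (hh.const_mul 2), integral_add (hf.const_mul r) (hg.const_mul t),
      integral_const_mul, integral_const_mul, integral_const_mul]
  have expand : ∀ {f g : Ω → ℝ}, MemLp f 2 μ → MemLp g 2 μ → ∫ ω, (f ω - g ω) ^ 2 ∂μ =
      ∫ ω, f ω * f ω ∂μ - 2 * ∫ ω, f ω * g ω ∂μ + ∫ ω, g ω * g ω ∂μ := by
    intro f g hf hg
    have h := lin 1 1 (i1 hf hf) (i1 hg hg) (i1 hf hg)
    have h2 : ∀ ω, (f ω - g ω) ^ 2 = 1 * (f ω * f ω) + 1 * (g ω * g ω) - 2 * (f ω * g ω) :=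
      fun ω => by ring
    simp only [h2]
    rw [h]
    ring
  rw [expand hX ha, hXa] at hκ
  rw [expand hY he, hYe] at hξ
  rw [expand hX hY, hXY, expand ha he]
  -- Only the difference of the estimates is unbiased, so their conditional means are `a + r` and `e
  -- + r` with a common bias `r`. Collecting terms leaves `-2 r²`, which is dropped.
  have hint : ∫ ω, (2 * (p ω * a ω) + 2 * (q ω * e ω) - 2 * (p ω * q ω)) ∂μ ≤
      ∫ ω, (2 * (a ω * a ω) + 2 * (e ω * e ω) - 2 * (a ω * e ω)) ∂μ := by
    refine integral_mono_ae
      ((((i1 hpL ha).const_mul 2).add ((i1 hqL he).const_mul 2)).sub ((i1 hpL hqL).const_mul 2))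
      ((((i1 ha ha).const_mul 2).add ((i1 he he).const_mul 2)).sub ((i1 ha he).const_mul 2)) ?_
    filter_upwards [hpq] with ω h
    have h' : p ω = a ω + (q ω - e ω) := by linarith
    rw [h']
    nlinarith [sq_nonneg (q ω - e ω)]
  rw [lin 2 2 (i1 hpL ha) (i1 hqL he) (i1 hpL hqL), lin 2 2 (i1 ha ha) (i1 he he) (i1 ha he)] at hint
  linarith

end Variance

/-! ### Continuity and boundedness of Gibbs expectations -/

section Regularity

variable {n m : ℕ} {H : Fin m → Op n}

open scoped Matrix.Norms.L2Operator in
lemma continuous_exp_op : Continuous (fun A : Op n => NormedSpace.exp A) :=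
  letI : NormedAlgebra ℚ (Op n) := NormedAlgebra.restrictScalars ℚ ℂ (Op n)
  NormedSpace.exp_continuous

lemma continuous_expVal_gibbs (hH : ∀ i, (H i).IsHermitian) (A : Op n) :
    Continuous fun θ => expVal A (gibbs H θ) := by
  simp only [expVal_gibbs hH]
  have hham : Continuous fun θ : EuclideanSpace ℝ (Fin m) => hamiltonian H θ := by
    unfold hamiltonian
    fun_prop
  have hexp := continuous_exp_op.comp hham
  refine Continuous.div ?_ ?_ fun θ => (partitionFn_pos (isHermitian_hamiltonian hH θ)).ne'
  · exact Complex.continuous_re.comp ((hexp.matrix_mul continuous_const).matrix_trace)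
  · exact Complex.continuous_re.comp hexp.matrix_trace

lemma abs_expVal_gibbs_le (hH : ∀ i, (H i).IsHermitian) (hH1 : ∀ i, specNorm (H i) ≤ 1)
    (θ : EuclideanSpace ℝ (Fin m)) (i : Fin m) : |expVal (H i) (gibbs H θ)| ≤ 1 := by
  have hX := isHermitian_hamiltonian hH θ
  have h := abs_trace_exp_mul_sub_le hX (hX.add (hH i)) (β := 1) (by
    rw [add_sub_cancel_left]; exact hH1 i)
  rw [add_sub_cancel_left, one_mul] at h
  rw [expVal_gibbs hH, abs_div, abs_of_pos (partitionFn_pos hX), div_le_one (partitionFn_pos hX)]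
  exact h

end Regularity

/-! ### Stochastic gradient descent in expectation -/

section Descent

variable {n m : ℕ} {H : Fin m → Op n} {η : Op n} {κ ξ : ℝ} {γ : ℕ → ℝ}
  {θ₀ θopt : EuclideanSpace ℝ (Fin m)} {T : ℕ}
  {Ω : Type*} [mΩ : MeasurableSpace Ω] {μ : Measure Ω} [IsProbabilityMeasure μ] {ℱ : Filtration ℕ mΩ}
  {θ : ℕ → Ω → EuclideanSpace ℝ (Fin m)} {hρ hη : ℕ → Ω → Fin m → ℝ}

namespace IsSGDRun

/-- Each iterate is a fixed vector plus finitely many square-integrable estimates. -/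
lemma memLp_iterate (run : IsSGDRun H η γ κ ξ θ₀ T μ ℱ θ hρ hη) {t : ℕ} (ht : t ≤ T) :
    MemLp (θ t) 2 μ := by
  induction t with
  | zero =>
    exact (memLp_congr_ae (f := fun _ => θ₀) (by
      filter_upwards [run.init] with ω h using h.symm)).1 (memLp_const θ₀)
  | succ t ih =>
    have ih' := ih (by omega)
    refine MemLp.of_eval_piLp fun i => ?_
    refine (memLp_congr_ae (f := fun ω => θ t ω i - γ t * (hρ t ω i - hη t ω i)) ?_).1 ?_
    · filter_upwards [run.update t (by omega)] with ω h using (h i).symm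
    · exact (ih'.eval_piLp i).sub
        (((run.memLp_model t (by omega) i).sub (run.memLp_data t (by omega) i)).const_mul (γ t))

variable (hH : ∀ i, (H i).IsHermitian) (hη' : IsDensity η) (hH1 : ∀ i, specNorm (H i) ≤ 1)
include hH hη' hH1

/-- The loss is bounded below by its minimum and above, by smoothness at `0`, by a quadratic in the
square-integrable iterate. -/
lemma integrable_loss (run : IsSGDRun H η γ κ ξ θ₀ T μ ℱ θ hρ hη)
    (hopt : ∀ θ, loss H η θopt ≤ loss H η θ) {t : ℕ} (ht : t ≤ T) :
    Integrable (fun ω => loss H η (θ t ω)) μ := by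
  have hL := run.memLp_iterate ht
  have hcont : Continuous (loss H η) := continuous_iff_continuousAt.2 fun θ =>
    (hasGradientAt_loss hH hη' hH1 θ).continuousAt
  have hb : Integrable (fun ω => |loss H η θopt| + (|loss H η 0| + ‖lossGrad H η 0‖ * ‖θ t ω‖ +
      m / 2 * ‖θ t ω‖ ^ 2)) μ :=
    (integrable_const _).add (((integrable_const _).add
      ((hL.integrable (by norm_num)).norm.const_mul _)).add ((hL.norm.integrable_sq).const_mul _))
  refine hb.mono' (hcont.comp_aestronglyMeasurable hL.1) (Filter.Eventually.of_forall fun ω => ?_)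
  have h1 := hopt (θ t ω)
  have h2 := loss_add_le hH hη' hH1 0 (θ t ω)
  rw [zero_add] at h2
  have h3 := real_inner_le_norm (lossGrad H η 0) (θ t ω)
  have h4 : (0 : ℝ) ≤ m / 2 * ‖θ t ω‖ ^ 2 := by positivity
  have h5 : 0 ≤ ‖lossGrad H η 0‖ * ‖θ t ω‖ := by positivity
  rw [Real.norm_eq_abs, abs_le]
  constructor
  · linarith [neg_abs_le (loss H η θopt), abs_nonneg (loss H η 0)]
  · linarith [le_abs_self (loss H η 0), abs_nonneg (loss H η θopt)]

omit hη' in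
lemma memLp_model_expVal (run : IsSGDRun H η γ κ ξ θ₀ T μ ℱ θ hρ hη) (t : ℕ) (i : Fin m) :
    MemLp (fun ω => expVal (H i) (gibbs H (θ t ω))) 2 μ :=
  MemLp.of_bound ((continuous_expVal_gibbs hH (H i)).comp_aestronglyMeasurable
    ((run.adapted t).mono (ℱ.le t)).aestronglyMeasurable) 1
    (Filter.Eventually.of_forall fun _ => abs_expVal_gibbs_le hH hH1 _ i)

omit hη' in
lemma memLp_lossGrad (run : IsSGDRun H η γ κ ξ θ₀ T μ ℱ θ hρ hη) (t : ℕ) (i : Fin m) :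
    MemLp (fun ω => lossGrad H η (θ t ω) i) 2 μ :=
  (run.memLp_model_expVal hH hH1 t i).sub (memLp_const (expVal (H i) η))

lemma integral_sq_estimate_le (run : IsSGDRun H η γ κ ξ θ₀ T μ ℱ θ hρ hη) {t : ℕ} (ht : t < T)
    (i : Fin m) :
    ∫ ω, (hρ t ω i - hη t ω i) ^ 2 ∂μ ≤
      ∫ ω, lossGrad H η (θ t ω) i ^ 2 ∂μ + (κ ^ 2 + ξ ^ 2) := by
  refine integral_sq_sub_le (ℱ.le t) (run.memLp_model t ht i) (run.memLp_data t ht i)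
    (run.memLp_model_expVal hH hH1 t i) (memLp_const (expVal (H i) η))
    ((continuous_expVal_gibbs hH (H i)).comp_stronglyMeasurable (run.adapted t))
    stronglyMeasurable_const ?_ (run.uncorrelated t ht i) (run.precision_model t ht i)
    (run.precision_data t ht i)
  refine (run.unbiased t ht i).trans (Filter.Eventually.of_forall fun ω => ?_)
  simp only [gradient_loss hH hη' hH1]
  rfl

lemma integral_lossGrad_mul_estimate (run : IsSGDRun H η γ κ ξ θ₀ T μ ℱ θ hρ hη) {t : ℕ}
    (ht : t < T) (i : Fin m) :
    ∫ ω, (hρ t ω i - hη t ω i) * lossGrad H η (θ t ω) i ∂μ =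
      ∫ ω, lossGrad H η (θ t ω) i ^ 2 ∂μ := by
  refine (integral_mul_eq_integral_condExp_mul (ℱ.le t) ((run.memLp_model t ht i).sub
    (run.memLp_data t ht i)) (run.memLp_lossGrad hH hH1 t i)
    (((continuous_expVal_gibbs hH (H i)).comp_stronglyMeasurable (run.adapted t)).sub
      stronglyMeasurable_const)).trans (integral_congr_ae ?_)
  filter_upwards [run.unbiased t ht i] with ω h
  have h' : (μ[(fun ω => hρ t ω i) - (fun ω => hη t ω i) | ℱ t]) ω = lossGrad H η (θ t ω) i := by
    rw [gradient_loss hH hη' hH1] at h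
    exact h
  change (μ[(fun ω => hρ t ω i) - (fun ω => hη t ω i) | ℱ t]) ω * _ = _
  rw [h']
  ring

/-- One step of stochastic gradient descent, in expectation. -/
lemma integral_loss_succ_le (run : IsSGDRun H η γ κ ξ θ₀ T μ ℱ θ hρ hη)
    (hopt : ∀ θ, loss H η θopt ≤ loss H η θ) {Θ : Set (EuclideanSpace ℝ (Fin m))} {α : ℝ}
    (hα : 0 < α) (hsc : StrongConvexOn Θ α (loss H η)) (hoptΘ : θopt ∈ Θ)
    {t : ℕ} (ht : t < T) (hΘ : ∀ᵐ ω ∂μ, θ t ω ∈ Θ) (hγ0 : 0 ≤ γ t) (hγ : m * γ t ≤ 1) :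
    ∫ ω, (loss H η (θ (t + 1) ω) - loss H η θopt) ∂μ ≤
      (1 - α * γ t) * ∫ ω, (loss H η (θ t ω) - loss H η θopt) ∂μ +
        (m : ℝ) ^ 2 * (κ ^ 2 + ξ ^ 2) / 2 * γ t ^ 2 := by
  have iL := run.integrable_loss hH hη' hH1 hopt ht.le
  have iL' := run.integrable_loss hH hη' hH1 hopt (Nat.succ_le_of_lt ht)
  have iD : Integrable (fun ω => loss H η (θ t ω) - loss H η θopt) μ :=
    iL.sub (integrable_const _)
  have mest : ∀ i, MemLp (fun ω => hρ t ω i - hη t ω i) 2 μ := fun i =>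
    (run.memLp_model t ht i).sub (run.memLp_data t ht i)
  have mg := fun i => run.memLp_lossGrad hH hH1 t i
  have i1 : ∀ i, Integrable (fun ω => (hρ t ω i - hη t ω i) * lossGrad H η (θ t ω) i) μ :=
    fun i => (mest i).integrable_mul (mg i)
  have i2 : ∀ i, Integrable (fun ω => (hρ t ω i - hη t ω i) ^ 2) μ := fun i =>
    (mest i).integrable_sq
  have i3 : ∀ i, Integrable (fun ω => lossGrad H η (θ t ω) i ^ 2) μ := fun i => (mg i).integrable_sq
  have I1 : Integrable (fun ω => γ t * ∑ i, (hρ t ω i - hη t ω i) * lossGrad H η (θ t ω) i) μ :=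
    (integrable_finsetSum _ fun i _ => i1 i).const_mul _
  have I2 : Integrable (fun ω => m / 2 * γ t ^ 2 * ∑ i, (hρ t ω i - hη t ω i) ^ 2) μ :=
    (integrable_finsetSum _ fun i _ => i2 i).const_mul _
  have I3 : Integrable (fun ω => ∑ i, lossGrad H η (θ t ω) i ^ 2) μ :=
    integrable_finsetSum _ fun i _ => i3 i
  set G := ∫ ω, ∑ i, lossGrad H η (θ t ω) i ^ 2 ∂μ with hG
  have hstep : ∫ ω, (loss H η (θ (t + 1) ω) - loss H η θopt) ∂μ ≤
      ∫ ω, (loss H η (θ t ω) - loss H η θopt -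
        γ t * ∑ i, (hρ t ω i - hη t ω i) * lossGrad H η (θ t ω) i +
        m / 2 * γ t ^ 2 * ∑ i, (hρ t ω i - hη t ω i) ^ 2) ∂μ := by
    refine integral_mono_ae (iL'.sub (integrable_const _)) ((iD.sub I1).add I2) ?_
    filter_upwards [run.update t ht] with ω h
    set v : EuclideanSpace ℝ (Fin m) := WithLp.toLp 2 fun i => -(γ t * (hρ t ω i - hη t ω i)) with hv
    have hθ : θ (t + 1) ω = θ t ω + v := by
      ext i
      rw [h i]
      simp [hv, sub_eq_add_neg]
    have h1 := loss_add_le hH hη' hH1 (θ t ω) v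
    rw [← hθ] at h1
    have h2 : inner ℝ (lossGrad H η (θ t ω)) v =
        -(γ t * ∑ i, (hρ t ω i - hη t ω i) * lossGrad H η (θ t ω) i) := by
      rw [PiLp.inner_apply, Finset.mul_sum, ← Finset.sum_neg_distrib]
      refine Finset.sum_congr rfl fun i _ => ?_
      simp [hv]
      ring
    have h3 : ‖v‖ ^ 2 = γ t ^ 2 * ∑ i, (hρ t ω i - hη t ω i) ^ 2 := by
      rw [EuclideanSpace.norm_sq_eq, Finset.mul_sum]
      refine Finset.sum_congr rfl fun i _ => ?_
      simp [hv, mul_pow]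
    rw [h2, h3] at h1
    linarith
  have hsplit : ∫ ω, (loss H η (θ t ω) - loss H η θopt -
        γ t * ∑ i, (hρ t ω i - hη t ω i) * lossGrad H η (θ t ω) i +
        m / 2 * γ t ^ 2 * ∑ i, (hρ t ω i - hη t ω i) ^ 2) ∂μ =
      ∫ ω, (loss H η (θ t ω) - loss H η θopt) ∂μ - γ t * G +
        m / 2 * γ t ^ 2 * ∑ i, ∫ ω, (hρ t ω i - hη t ω i) ^ 2 ∂μ := by
    have iDI : Integrable (fun ω => loss H η (θ t ω) - loss H η θopt -
        γ t * ∑ i, (hρ t ω i - hη t ω i) * lossGrad H η (θ t ω) i) μ := iD.sub I1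
    rw [integral_add iDI I2, integral_sub iD I1, integral_const_mul, integral_const_mul,
      integral_finsetSum _ fun i _ => i1 i, integral_finsetSum _ fun i _ => i2 i, hG,
      integral_finsetSum _ fun i _ => i3 i]
    simp only [run.integral_lossGrad_mul_estimate hH hη' hH1 ht]
  have hnoise : ∑ i, ∫ ω, (hρ t ω i - hη t ω i) ^ 2 ∂μ ≤ G + m * (κ ^ 2 + ξ ^ 2) := by
    rw [hG, integral_finsetSum _ fun i _ => i3 i]
    calc _ ≤ ∑ i : Fin m, (∫ ω, lossGrad H η (θ t ω) i ^ 2 ∂μ + (κ ^ 2 + ξ ^ 2)) :=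
          Finset.sum_le_sum fun i _ => run.integral_sq_estimate_le hH hη' hH1 ht i
      _ = _ := by rw [Finset.sum_add_distrib]; simp [-mul_eq_mul_left_iff]; ring
  have hPL : 2 * α * ∫ ω, (loss H η (θ t ω) - loss H η θopt) ∂μ ≤ G := by
    rw [← integral_const_mul]
    refine integral_mono_ae (iD.const_mul _) I3 ?_
    filter_upwards [hΘ] with ω h
    have := polyak_lojasiewicz hH hη' hα hsc h hoptΘ
    rw [EuclideanSpace.norm_sq_eq] at this
    simpa using this
  have hG0 : 0 ≤ G := integral_nonneg fun ω => Finset.sum_nonneg fun i _ => sq_nonneg _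
  have h1 : m / 2 * γ t ^ 2 * ∑ i, ∫ ω, (hρ t ω i - hη t ω i) ^ 2 ∂μ ≤
      m / 2 * γ t ^ 2 * (G + m * (κ ^ 2 + ξ ^ 2)) :=
    mul_le_mul_of_nonneg_left hnoise (by positivity)
  -- Because `m γ ≤ 1`, the second-order term eats at most half of the descent `γ G`; the other half
  -- feeds Polyak–Łojasiewicz.
  have h2 : m / 2 * γ t ^ 2 * G ≤ γ t / 2 * G := by
    refine mul_le_mul_of_nonneg_right ?_ hG0
    nlinarith
  have h3 := mul_le_mul_of_nonneg_left hPL (by linarith : 0 ≤ γ t / 2)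
  rw [hsplit] at hstep
  linarith

/-- Convergence of the expected gradient coordinates. -/
lemma integral_abs_lossGrad_le {α b ε : ℝ} {Θ : Set (EuclideanSpace ℝ (Fin m))} (hm : 0 < m)
    (run : IsSGDRun H η (stepSize α b T) κ ξ θ₀ T μ ℱ θ hρ hη)
    (hα : 0 < α) (hκ : 0 < κ) (hε : 0 < ε) (hsc : StrongConvexOn Θ α (loss H η)) (hoptΘ : θopt ∈ Θ)
    (hopt : ∀ θ, loss H η θopt ≤ loss H η θ) (hb : 4 * (m : ℝ) ≤ b)
    (hT1 : 18 * (m : ℝ) ^ 2 * (κ ^ 2 + ξ ^ 2) / (α ^ 2 * ε ^ 2) ≤ T)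
    (hT2 : 2 * b / α * Real.log (4 * (loss H η θ₀ - loss H η θopt) / ε ^ 2) ≤ T)
    (hΘ : ∀ t ≤ T, ∀ᵐ ω ∂μ, θ t ω ∈ Θ) (i : Fin m) :
    ∫ ω, |lossGrad H η (θ T ω) i| ∂μ ≤ ε := by
  have hm' : (0 : ℝ) < m := by exact_mod_cast hm
  have hb0 : 0 < b := by linarith
  have mg := run.memLp_lossGrad hH hH1 T i
  have iabs : Integrable (fun ω => |lossGrad H η (θ T ω) i|) μ := (mg.integrable (by norm_num)).abs
  have hT0 : (0 : ℝ) < T := lt_of_lt_of_le (by positivity) hT1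
  -- On a one-point `Θ` strong convexity holds for every modulus and `α ≤ m` may fail, but there the
  -- gradient vanishes.
  by_cases hsing : ∀ x ∈ Θ, x = θopt
  · have h0 : ∀ᵐ ω ∂μ, |lossGrad H η (θ T ω) i| = 0 := by
      filter_upwards [hΘ T le_rfl] with ω h
      rw [hsing _ h, abs_eq_zero]
      have h := sq_lossGrad_le hH hη' hH1 hopt θopt i
      rw [sub_self, mul_zero] at h
      exact pow_eq_zero_iff two_ne_zero |>.1 (le_antisymm h (sq_nonneg _))
    rw [integral_congr_ae h0]
    simpa using hε.le
  push Not at hsing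
  obtain ⟨x, hxΘ, hx⟩ := hsing
  have hαm : α ≤ m := strongConvexity_le hH hη' hH1 hsc hxΘ hoptΘ hopt hx
  set d : ℕ → ℝ := fun t => ∫ ω, (loss H η (θ t ω) - loss H η θopt) ∂μ with hd
  have hd0 : d 0 = loss H η θ₀ - loss H η θopt := by
    have : ∀ᵐ ω ∂μ, loss H η (θ 0 ω) - loss H η θopt = loss H η θ₀ - loss H η θopt := by
      filter_upwards [run.init] with ω h
      rw [h]
    simp only [hd]
    rw [integral_congr_ae this]
    simp
  have hrec := le_of_stepSize_recursion (d := d) (T := T) hα hb0 (by linarith)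
    (by exact_mod_cast hT0) (fun t => integral_nonneg fun ω => sub_nonneg.2 (hopt _))
    (c := (m : ℝ) ^ 2 * (κ ^ 2 + ξ ^ 2) / 2) (by positivity) (fun t ht => by
      refine run.integral_loss_succ_le hH hη' hH1 hopt hα hsc hoptΘ ht (hΘ t ht.le)
        (stepSize_nonneg hα hb0 T t) ?_
      calc (m : ℝ) * stepSize α b T t ≤ m * (1 / b) :=
            mul_le_mul_of_nonneg_left (stepSize_le hα hb0 T t) hm'.le
        _ ≤ 1 := by rw [mul_one_div, div_le_one hb0]; linarith)
  -- The first condition on `T` gives `4 ε² / 18`, below `ε² / 4`.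
  have hnoise : 8 * ((m : ℝ) ^ 2 * (κ ^ 2 + ξ ^ 2) / 2) / (α ^ 2 * T) ≤ ε ^ 2 / 4 := by
    rw [div_le_iff₀ (by positivity)] at hT1 ⊢
    have : 0 ≤ (m : ℝ) ^ 2 * (κ ^ 2 + ξ ^ 2) := by positivity
    nlinarith
  have hinit : Real.exp (-(α * T / (2 * b))) * d 0 ≤ ε ^ 2 / 4 := by
    rw [hd0]
    set δ := loss H η θ₀ - loss H η θopt with hδ
    -- For `δ = 0` the logarithm takes its default value `0` and carries no information, but the
    -- term itself vanishes.
    rcases (sub_nonneg.2 (hopt θ₀) : 0 ≤ δ).eq_or_lt with h | h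
    · rw [hδ, ← h, mul_zero]; positivity
    · have h1 : Real.log (4 * δ / ε ^ 2) ≤ α * T / (2 * b) := by
        rw [le_div_iff₀ (by positivity)]
        rw [div_mul_eq_mul_div, div_le_iff₀ hα] at hT2
        linarith
      have h2 : 4 * δ / ε ^ 2 ≤ Real.exp (α * T / (2 * b)) :=
        (Real.log_le_iff_le_exp (by positivity)).1 h1
      rw [Real.exp_neg, inv_mul_le_iff₀ (Real.exp_pos _)]
      rw [div_le_iff₀ (by positivity)] at h2
      linarith
  have hdT : d T ≤ ε ^ 2 / 2 := by linarith
  have hsq : ∫ ω, lossGrad H η (θ T ω) i ^ 2 ∂μ ≤ ε ^ 2 := by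
    have h1 : ∫ ω, lossGrad H η (θ T ω) i ^ 2 ∂μ ≤
        ∫ ω, 2 * (loss H η (θ T ω) - loss H η θopt) ∂μ :=
      integral_mono mg.integrable_sq (((run.integrable_loss hH hη' hH1 hopt le_rfl).sub
        (integrable_const _)).const_mul 2) fun ω => sq_lossGrad_le hH hη' hH1 hopt _ i
    rw [integral_const_mul] at h1
    linarith
  -- From second to first moment by `2 ε |g| ≤ g² + ε²`.
  have h1 : ∫ ω, 2 * ε * |lossGrad H η (θ T ω) i| ∂μ ≤
      ∫ ω, (lossGrad H η (θ T ω) i ^ 2 + ε ^ 2) ∂μ :=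
    integral_mono (iabs.const_mul _) (mg.integrable_sq.add (integrable_const _)) fun ω => by
      have h2 := sq_nonneg (|lossGrad H η (θ T ω) i| - ε)
      have h3 := sq_abs (lossGrad H η (θ T ω) i)
      simp only
      nlinarith
  rw [integral_const_mul, integral_add mg.integrable_sq (integrable_const _)] at h1
  simp only [integral_const, probReal_univ, smul_eq_mul, one_mul] at h1
  have h2 : 2 * ε * ∫ ω, |lossGrad H η (θ T ω) i| ∂μ ≤ 2 * ε * ε := by linarith
  exact le_of_mul_le_mul_left h2 (by positivity)

end IsSGDRun

end Descent

/-! ### Positive semidefinite matrices -/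

section PosSemidef

variable {D : Type*} [Fintype D] [DecidableEq D]

open scoped MatrixOrder Matrix.Norms.L2Operator in
lemma exists_eq_conjTranspose_mul_self {A : Matrix D D ℂ} (hA : A.PosSemidef) :
    ∃ B : Matrix D D ℂ, A = Bᴴ * B :=
  CStarAlgebra.nonneg_iff_eq_star_mul_self.mp hA.nonneg

lemma trace_mul_nonneg_of_posSemidef {A B : Matrix D D ℂ} (hA : A.PosSemidef)
    (hB : B.PosSemidef) : 0 ≤ (A * B).trace := by
  obtain ⟨C, rfl⟩ := exists_eq_conjTranspose_mul_self hA
  rw [Matrix.mul_assoc, Matrix.trace_mul_comm]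
  exact (hB.mul_mul_conjTranspose_same C).trace_nonneg

lemma ofReal_re_of_nonneg {z : ℂ} (h : 0 ≤ z) : ((z.re : ℝ) : ℂ) = z := by
  apply Complex.ext
  · simp
  · simpa using (Complex.nonneg_iff.1 h).2

end PosSemidef

/-! ### Tensor products of matrices -/

section TensorPower

set_option linter.unusedSectionVars false

variable {J D : Type*} [Fintype J] [DecidableEq J] [Fintype D] [DecidableEq D]

/-- The tensor product of a finite family of square matrices. -/
def piKron {J D : Type*} [Fintype J] (A : J → Matrix D D ℂ) : Matrix (J → D) (J → D) ℂ :=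
  Matrix.of fun x y => ∏ k, A k (x k) (y k)

lemma piKron_mul (A B : J → Matrix D D ℂ) :
    piKron A * piKron B = piKron fun k => A k * B k := by
  ext x y
  simp only [piKron, Matrix.mul_apply, Matrix.of_apply, Finset.prod_univ_sum,
    Fintype.piFinset_univ, Finset.prod_mul_distrib]

lemma piKron_conjTranspose (A : J → Matrix D D ℂ) :
    (piKron A)ᴴ = piKron fun k => (A k)ᴴ := by
  ext x y
  simp [piKron, Matrix.conjTranspose_apply]

lemma piKron_one : piKron (fun _ : J => (1 : Matrix D D ℂ)) = 1 := by
  ext x y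
  simp only [piKron, Matrix.of_apply, Matrix.one_apply, Finset.prod_ite_zero, Finset.prod_const_one]
  simp [funext_iff]

lemma trace_piKron (A : J → Matrix D D ℂ) : (piKron A).trace = ∏ k, (A k).trace := by
  simp only [piKron, Matrix.trace, Matrix.diag_apply, Matrix.of_apply, Finset.prod_univ_sum,
    Fintype.piFinset_univ]

lemma sum_piKron {X : Type*} [Fintype X] (E : X → Matrix D D ℂ) :
    ∑ x : J → X, piKron (fun k => E (x k)) = piKron fun _ => ∑ x, E x := by
  ext a b
  simp only [piKron, Matrix.sum_apply, Matrix.of_apply, Finset.prod_univ_sum,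
    Fintype.piFinset_univ]

lemma posSemidef_piKron {A : J → Matrix D D ℂ} (hA : ∀ k, (A k).PosSemidef) :
    (piKron A).PosSemidef := by
  choose B hB using fun k => exists_eq_conjTranspose_mul_self (hA k)
  have : piKron A = (piKron B)ᴴ * piKron B := by
    rw [piKron_conjTranspose, piKron_mul]
    congr 1
    exact funext hB
  rw [this]
  exact Matrix.posSemidef_conjTranspose_mul_self _

end TensorPower

/-! ### Measurements: products, adaptive composition, reindexing -/

open scoped Kronecker

/-- A measurement with outcomes in `X` of a quantum system with basis `D`. -/
structure POVM (D X : Type*) [Fintype D] [DecidableEq D] [Fintype X] where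
  effect : X → Matrix D D ℂ
  posSemidef : ∀ x, (effect x).PosSemidef
  sum_effect : ∑ x, effect x = 1

namespace POVM

variable {D D' X Y : Type*} [Fintype D] [DecidableEq D] [Fintype D'] [DecidableEq D'] [Fintype X]
  [Fintype Y]

/-- The Born probability of an outcome. -/
def prob (E : POVM D X) (S : Matrix D D ℂ) (x : X) : ℝ := (E.effect x * S).trace.re

lemma trace_effect_mul (E : POVM D X) {S : Matrix D D ℂ} (hS : S.PosSemidef) (x : X) :
    (E.effect x * S).trace = (E.prob S x : ℂ) :=
  (ofReal_re_of_nonneg (trace_mul_nonneg_of_posSemidef (E.posSemidef x) hS)).symm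

lemma prob_nonneg (E : POVM D X) {S : Matrix D D ℂ} (hS : S.PosSemidef) (x : X) :
    0 ≤ E.prob S x :=
  (Complex.nonneg_iff.1 (trace_mul_nonneg_of_posSemidef (E.posSemidef x) hS)).1

lemma sum_prob (E : POVM D X) {S : Matrix D D ℂ} (hS : S.trace = 1) : ∑ x, E.prob S x = 1 := by
  simp only [prob]
  rw [← Complex.re_sum, ← Matrix.trace_sum, ← Finset.sum_mul, E.sum_effect, Matrix.one_mul, hS,
    Complex.one_re]

/-- The same measurement on each of several systems. -/
def pi (E : POVM D X) (J : Type*) [Fintype J] [DecidableEq J] : POVM (J → D) (J → X) where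
  effect x := piKron fun k => E.effect (x k)
  posSemidef x := posSemidef_piKron fun k => E.posSemidef (x k)
  sum_effect := by rw [sum_piKron, E.sum_effect, piKron_one]

lemma prob_pi (E : POVM D X) {J : Type*} [Fintype J] [DecidableEq J] {S : Matrix D D ℂ}
    (hS : S.PosSemidef) (x : J → X) :
    (E.pi J).prob (piKron fun _ => S) x = ∏ k, E.prob S (x k) := by
  rw [prob, pi, piKron_mul, trace_piKron]
  simp only [E.trace_effect_mul hS]
  rw [← Complex.ofReal_prod, Complex.ofReal_re]

/-- A measurement of a second system that depends on the outcome on the first one. -/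
def adaptive (E : POVM D X) (F : X → POVM D' Y) : POVM (D × D') (X × Y) where
  effect z := E.effect z.1 ⊗ₖ (F z.1).effect z.2
  posSemidef z := (E.posSemidef z.1).kronecker ((F z.1).posSemidef z.2)
  sum_effect := by
    rw [Fintype.sum_prod_type]
    have h : ∀ x, ∑ y, E.effect x ⊗ₖ (F x).effect y = E.effect x ⊗ₖ (1 : Matrix D' D' ℂ) := by
      intro x
      rw [← (F x).sum_effect]
      ext a b
      simp [Matrix.sum_apply, Finset.mul_sum]
    simp only [h]
    rw [← Matrix.one_kronecker_one, ← E.sum_effect]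
    ext a b
    simp [Matrix.sum_apply, Finset.sum_mul]

lemma prob_adaptive (E : POVM D X) (F : X → POVM D' Y) {S : Matrix D D ℂ} {S' : Matrix D' D' ℂ}
    (hS : S.PosSemidef) (hS' : S'.PosSemidef) (z : X × Y) :
    (E.adaptive F).prob (S ⊗ₖ S') z = E.prob S z.1 * (F z.1).prob S' z.2 := by
  rw [prob, adaptive]
  simp only
  rw [← Matrix.mul_kronecker_mul, Matrix.trace_kronecker, E.trace_effect_mul hS,
    (F z.1).trace_effect_mul hS', ← Complex.ofReal_mul, Complex.ofReal_re]

/-- Transport of a measurement along an identification of bases. -/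
def reindex (E : POVM D X) (e : D' ≃ D) : POVM D' X where
  effect x := (E.effect x).submatrix e e
  posSemidef x := (E.posSemidef x).submatrix e
  sum_effect := by
    have : ∑ x, (E.effect x).submatrix e e = (∑ x, E.effect x).submatrix e e := by
      ext a b
      simp [Matrix.sum_apply]
    rw [this, E.sum_effect, Matrix.submatrix_one_equiv]

lemma prob_reindex (E : POVM D X) (e : D' ≃ D) (S : Matrix D D ℂ) (x : X) :
    (E.reindex e).prob (S.submatrix e e) x = E.prob S x := by
  rw [prob, prob, reindex]
  simp only
  rw [Matrix.submatrix_mul_equiv]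
  exact congrArg Complex.re (Equiv.sum_comp e fun a => (E.effect x * S) a a)

/-- A measurement of `N` preparations with post-processing, as a protocol. -/
noncomputable def toProtocol {n N m : ℕ} (E : POVM (Fin N → Qubits n) X) (f : X → Fin m → ℝ) :
    Protocol n N m where
  numOutcomes := Fintype.card X
  effect x := E.effect ((Fintype.equivFin X).symm x)
  posSemidef x := E.posSemidef _
  sum_effect := by
    rw [Equiv.sum_comp (Fintype.equivFin X).symm E.effect, E.sum_effect]
  estimate x := f ((Fintype.equivFin X).symm x)

open Classical in
lemma successProb_toProtocol {n N m : ℕ} (E : POVM (Fin N → Qubits n) X) (f : X → Fin m → ℝ)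
    (H : Fin m → Op n) (κ : ℝ) (ρ : Op n) :
    (E.toProtocol f).successProb H κ ρ =
      ∑ x with ∀ i, |f x i - expVal (H i) ρ| ≤ κ, E.prob (copies N ρ) x := by
  rw [Protocol.successProb, Finset.sum_filter, Finset.sum_filter]
  rw [← Equiv.sum_comp (Fintype.equivFin X).symm]
  refine Finset.sum_congr rfl fun x _ => ?_
  by_cases h : (E.toProtocol f).Good H κ ρ x
  · rw [if_pos h, if_pos (by exact h)]
    rfl
  · rw [if_neg h, if_neg (by exact h)]

end POVM

/-! ### Pauli algebra, twirling and Bell sampling -/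

section Pauli

variable {n : ℕ}

lemma pauliString_eq_piKron (p : Fin n → Fin 4) : pauliString p = piKron fun k => pauli (p k) := rfl

lemma pauli_conjTranspose (a : Fin 4) : (pauli a)ᴴ = pauli a := by
  fin_cases a <;> ext i j <;> fin_cases i <;> fin_cases j <;> simp [pauli]

lemma pauli_mul_self (a : Fin 4) : pauli a * pauli a = 1 := by
  fin_cases a <;> ext i j <;> fin_cases i <;> fin_cases j <;> simp [pauli, Matrix.mul_apply]

/-- `1` if two single-qubit Pauli matrices commute and `-1` if they anticommute. -/
def pauliSign (a b : Fin 4) : ℝ := if a = 0 ∨ b = 0 ∨ a = b then 1 else -1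

lemma pauli_mul_comm (a b : Fin 4) :
    pauli a * pauli b = (pauliSign a b : ℂ) • (pauli b * pauli a) := by
  fin_cases a <;> fin_cases b <;> ext i j <;> fin_cases i <;> fin_cases j <;>
    simp [pauli, pauliSign, Matrix.mul_apply]

/-- `1` for the symmetric single-qubit Pauli matrices, `-1` for `Y`. -/
def transposeSign (a : Fin 4) : ℝ := if a = 2 then -1 else 1

lemma pauli_transpose (a : Fin 4) : (pauli a)ᵀ = (transposeSign a : ℂ) • pauli a := by
  fin_cases a <;> ext i j <;> fin_cases i <;> fin_cases j <;> simp [pauli, transposeSign]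

/-- In matrix form `∑ P ⊗ P = 2 SWAP`. Both the twirl and the completeness of the Bell basis come
from this. -/
lemma sum_pauli_mul_pauli (a b c d : Fin 2) :
    ∑ q, pauli q a b * pauli q c d = if a = d ∧ b = c then 2 else 0 := by
  fin_cases a <;> fin_cases b <;> fin_cases c <;> fin_cases d <;>
    simp [pauli, Fin.sum_univ_four] <;> norm_num

lemma pauliString_isHermitian (p : Fin n → Fin 4) : (pauliString p).IsHermitian := by
  rw [Matrix.IsHermitian, pauliString_eq_piKron, piKron_conjTranspose]
  simp only [pauli_conjTranspose]

lemma pauliString_mul_self (p : Fin n → Fin 4) : pauliString p * pauliString p = 1 := by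
  rw [pauliString_eq_piKron, piKron_mul]
  simp only [pauli_mul_self, piKron_one]

lemma piKron_smul {J D : Type*} [Fintype J] (c : J → ℂ) (A : J → Matrix D D ℂ) :
    piKron (fun k => c k • A k) = (∏ k, c k) • piKron A := by
  ext x y
  simp [piKron, Finset.prod_mul_distrib]

/-- The commutation sign of two Pauli operators. -/
def stringSign (p q : Fin n → Fin 4) : ℝ := ∏ k, pauliSign (p k) (q k)

lemma pauliString_mul_comm (p q : Fin n → Fin 4) :
    pauliString p * pauliString q = (stringSign p q : ℂ) • (pauliString q * pauliString p) := by
  simp only [pauliString_eq_piKron, piKron_mul]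
  simp only [pauli_mul_comm (p _) (q _)]
  rw [piKron_smul, stringSign, Complex.ofReal_prod]

lemma abs_stringSign (p q : Fin n → Fin 4) : |stringSign p q| = 1 := by
  rw [stringSign, Finset.abs_prod]
  refine Finset.prod_eq_one fun k _ => ?_
  unfold pauliSign
  split_ifs <;> simp

/-- The sign relating a Pauli operator to its transpose. -/
def stringTransposeSign (p : Fin n → Fin 4) : ℝ := ∏ k, transposeSign (p k)

lemma abs_stringTransposeSign (p : Fin n → Fin 4) : |stringTransposeSign p| = 1 := by
  rw [stringTransposeSign, Finset.abs_prod]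
  refine Finset.prod_eq_one fun k _ => ?_
  unfold transposeSign
  split_ifs <;> simp

lemma pauliString_transpose (p : Fin n → Fin 4) :
    (pauliString p)ᵀ = (stringTransposeSign p : ℂ) • pauliString p := by
  have : (pauliString p)ᵀ = piKron fun k => (pauli (p k))ᵀ := rfl
  rw [this]
  simp only [pauli_transpose]
  rw [piKron_smul, stringTransposeSign, Complex.ofReal_prod, pauliString_eq_piKron]

/-- The Pauli operators are a complete orthogonal family. -/
lemma sum_pauliString_mul_pauliString (a b c d : Qubits n) :
    ∑ q, pauliString q a b * pauliString q c d = if a = d ∧ b = c then (2 : ℂ) ^ n else 0 := by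
  simp only [pauliString, Matrix.of_apply, ← Finset.prod_mul_distrib]
  have h := Finset.prod_univ_sum (fun _ : Fin n => (Finset.univ : Finset (Fin 4)))
    (fun k q => pauli q (a k) (b k) * pauli q (c k) (d k))
  rw [Fintype.piFinset_univ] at h
  rw [← h]
  simp only [sum_pauli_mul_pauli, Finset.prod_ite_zero, Finset.prod_const, Finset.card_univ,
    Fintype.card_fin]
  simp only [Finset.mem_univ, true_imp_iff, forall_and, funext_iff]

/-- The Pauli twirl is completely depolarizing. -/
lemma sum_pauliString_conj (A : Op n) :
    ∑ q, pauliString q * A * pauliString q = ((2 : ℂ) ^ n * A.trace) • (1 : Op n) := by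
  ext a d
  simp only [Matrix.sum_apply, Matrix.mul_apply, Finset.sum_mul]
  have h : ∀ b c : Qubits n, ∑ q, pauliString q a b * A b c * pauliString q c d =
      if a = d ∧ b = c then (2 : ℂ) ^ n * A b c else 0 := by
    intro b c
    have := sum_pauliString_mul_pauliString a b c d
    calc _ = A b c * ∑ q, pauliString q a b * pauliString q c d := by
          rw [Finset.mul_sum]; exact Finset.sum_congr rfl fun q _ => by ring
      _ = _ := by rw [this]; split_ifs <;> ring
  rw [Finset.sum_comm]
  calc _ = ∑ c, ∑ b, ∑ q, pauliString q a b * A b c * pauliString q c d :=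
        Finset.sum_congr rfl fun c _ => Finset.sum_comm
    _ = _ := by
      simp only [h, Matrix.smul_apply, Matrix.one_apply, Matrix.trace, Matrix.diag_apply]
      by_cases had : a = d
      · simp [had, Finset.mul_sum]
      · simp [had]

/-- The commutation sign moves `P` through `Q`, so each term is `P Q (P A) Q`, and the plain twirl
of `P A` leaves its trace. -/
lemma sum_stringSign_conj (p : Fin n → Fin 4) (A : Op n) :
    ∑ q, (stringSign p q : ℂ) • (pauliString q * A * pauliString q) =
      ((2 : ℂ) ^ n * (pauliString p * A).trace) • pauliString p := by
  have h : ∀ q, (stringSign p q : ℂ) • (pauliString q * A * pauliString q) =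
      pauliString p * (pauliString q * (pauliString p * A) * pauliString q) := by
    intro q
    calc _ = (stringSign p q : ℂ) • (pauliString q * (pauliString p * pauliString p)) * A *
            pauliString q := by rw [pauliString_mul_self]; simp
      _ = ((stringSign p q : ℂ) • (pauliString q * pauliString p)) * pauliString p * A *
            pauliString q := by simp only [Matrix.smul_mul, Matrix.mul_assoc]
      _ = _ := by rw [← pauliString_mul_comm]; simp only [Matrix.mul_assoc]
  simp only [h]
  rw [← Finset.mul_sum, sum_pauliString_conj, Matrix.mul_smul, Matrix.mul_one]

lemma ofReal_expVal {A ρ : Op n} (hA : A.IsHermitian) (hρ : IsDensity ρ) :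
    (expVal A ρ : ℂ) = (ρ * A).trace := by
  have h : star (ρ * A).trace = (ρ * A).trace := by
    rw [← Matrix.trace_conjTranspose, Matrix.conjTranspose_mul, hA.eq, hρ.1.isHermitian.eq,
      Matrix.trace_mul_comm]
  exact Complex.conj_eq_iff_re.1 h

lemma expVal_transpose (p : Fin n → Fin 4) (ρ : Op n) :
    expVal (pauliString p) ρᵀ = stringTransposeSign p * expVal (pauliString p) ρ := by
  have h : (ρᵀ * pauliString p).trace = (stringTransposeSign p : ℂ) * (ρ * pauliString p).trace := by
    rw [← Matrix.trace_transpose, Matrix.transpose_mul, Matrix.transpose_transpose,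
      pauliString_transpose, Matrix.smul_mul, Matrix.trace_smul, smul_eq_mul, Matrix.trace_mul_comm]
  rw [expVal, h, Complex.re_ofReal_mul, expVal]

lemma IsDensity.transpose {ρ : Op n} (hρ : IsDensity ρ) : IsDensity ρᵀ :=
  ⟨hρ.1.transpose, by rw [Matrix.trace_transpose, hρ.2]⟩

/-- The measurement whose effects are the Pauli rotations of a density matrix `σ`. -/
noncomputable def twirl (σ : Op n) (hσ : IsDensity σ) : POVM (Qubits n) (Fin n → Fin 4) where
  effect q := ((2 : ℂ) ^ n)⁻¹ • (pauliString q * σ * pauliString q)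
  posSemidef q := by
    refine Matrix.PosSemidef.smul ?_ (by
      have : (((2 : ℂ) ^ n)⁻¹) = (((2 : ℝ) ^ n)⁻¹ : ℝ) := by push_cast; rfl
      rw [this, Complex.zero_le_real]
      positivity)
    have h := hσ.1.mul_mul_conjTranspose_same (pauliString q)
    rwa [(pauliString_isHermitian q).eq] at h
  sum_effect := by
    rw [← Finset.smul_sum, sum_pauliString_conj, hσ.2, smul_smul, mul_one,
      inv_mul_cancel₀ (by positivity), one_smul]

/-- One measurement, chosen independently of `p`, yields for every Pauli operator simultaneously a
random sign with mean the product of the two expectations. -/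
lemma sum_stringSign_mul_prob_twirl {σ ρ : Op n} (hσ : IsDensity σ) (hρ : IsDensity ρ)
    (p : Fin n → Fin 4) :
    ∑ q, (twirl σ hσ).prob ρ q * stringSign p q =
      expVal (pauliString p) σ * expVal (pauliString p) ρ := by
  have h : ((∑ q, (twirl σ hσ).prob ρ q * stringSign p q : ℝ) : ℂ) =
      (expVal (pauliString p) σ : ℂ) * expVal (pauliString p) ρ := by
    push_cast
    simp only [← (twirl σ hσ).trace_effect_mul hρ.1]
    rw [ofReal_expVal (pauliString_isHermitian p) hσ, ofReal_expVal (pauliString_isHermitian p) hρ]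
    have h1 : ∀ q, ((twirl σ hσ).effect q * ρ).trace * (stringSign p q : ℂ) =
        ((2 : ℂ) ^ n)⁻¹ *
          (((stringSign p q : ℂ) • (pauliString q * σ * pauliString q)) * ρ).trace := by
      intro q
      simp only [twirl, Matrix.smul_mul, Matrix.trace_smul, smul_eq_mul]
      ring
    simp only [h1]
    rw [← Finset.mul_sum, ← Matrix.trace_sum, ← Finset.sum_mul, sum_stringSign_conj,
      Matrix.smul_mul, Matrix.trace_smul, smul_eq_mul, Matrix.trace_mul_comm σ,
      Matrix.trace_mul_comm ρ, ← mul_assoc, ← mul_assoc, inv_mul_cancel₀ (by positivity), one_mul]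
  exact_mod_cast h

/-- The Bell measurement of two `n`-qubit systems. -/
noncomputable def bell (n : ℕ) : POVM (Qubits n × Qubits n) (Fin n → Fin 4) where
  effect q := ((2 : ℂ) ^ n)⁻¹ •
    Matrix.vecMulVec (fun a => pauliString q a.1 a.2) (star fun a => pauliString q a.1 a.2)
  posSemidef q := by
    refine Matrix.PosSemidef.smul (Matrix.posSemidef_vecMulVec_self_star _) (by
      have : (((2 : ℂ) ^ n)⁻¹) = (((2 : ℝ) ^ n)⁻¹ : ℝ) := by push_cast; rfl
      rw [this, Complex.zero_le_real]
      positivity)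
  sum_effect := by
    ext a b
    have h := sum_pauliString_mul_pauliString a.1 a.2 b.2 b.1
    have h1 : ∀ q, star (pauliString q b.1 b.2) = pauliString q b.2 b.1 := fun q =>
      (pauliString_isHermitian q).apply b.2 b.1
    simp only [Matrix.sum_apply, Matrix.smul_apply, Matrix.vecMulVec_apply, Pi.star_apply, h1,
      smul_eq_mul]
    rw [← Finset.mul_sum, h, Matrix.one_apply]
    by_cases hab : a = b
    · rw [if_pos ⟨by rw [hab], by rw [hab]⟩, if_pos hab]
      exact inv_mul_cancel₀ (by positivity)
    · rw [if_neg (fun hc => hab (Prod.ext hc.1 hc.2)), if_neg hab, mul_zero]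

/-- Bell sampling of two copies of `ρ` has the statistics of the twirl of `ρᵀ` on `ρ`. -/
lemma prob_bell {ρ : Op n} (hρ : IsDensity ρ) (q : Fin n → Fin 4) :
    (bell n).prob (ρ ⊗ₖ ρ) q = (twirl ρᵀ hρ.transpose).prob ρ q := by
  have h1 : ∀ b : Qubits n × Qubits n, star (pauliString q b.1 b.2) = pauliString q b.2 b.1 :=
    fun b => (pauliString_isHermitian q).apply b.2 b.1
  rw [POVM.prob, POVM.prob, bell, twirl]
  simp only [Matrix.smul_mul, Matrix.trace_smul]
  congr 2
  -- The Bell vectors are vectorised Pauli operators, so one copy of `ρ` enters transposed; both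
  -- sides are the same sum over four indices.
  simp only [Matrix.trace, Matrix.diag_apply, Matrix.mul_apply, Matrix.vecMulVec_apply,
    Pi.star_apply, h1, Matrix.kroneckerMap_apply, Matrix.transpose_apply, Fintype.sum_prod_type,
    Finset.sum_mul]
  refine Finset.sum_congr rfl fun a1 _ => ?_
  rw [Finset.sum_comm]
  refine Finset.sum_congr rfl fun b1 _ => ?_
  rw [Finset.sum_comm]
  exact Finset.sum_congr rfl fun b2 _ => Finset.sum_congr rfl fun a2 _ => by ring

end Pauli

/-! ### Hoeffding bounds for finite distributions -/

section Concentration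

set_option linter.unusedSectionVars false

variable {X : Type*} [Fintype X] {w : X → ℝ}

/-- Hoeffding's lemma for a finite distribution. -/
lemma sum_mul_exp_le (hw : ∀ x, 0 ≤ w x) (hw1 : ∑ x, w x = 1) {f : X → ℝ} (hf : ∀ x, |f x| ≤ 1)
    (t : ℝ) :
    ∑ x, w x * Real.exp (t * (f x - ∑ y, w y * f y)) ≤ Real.exp (t ^ 2 / 2) := by
  let _ : MeasurableSpace X := ⊤
  let ν : Measure X := ∑ x, ENNReal.ofReal (w x) • Measure.dirac x
  have hint : ∀ g : X → ℝ, ∫ x, g x ∂ν = ∑ x, w x * g x := by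
    intro g
    rw [integral_finsetSum_measure fun x _ => (integrable_dirac (by simp)).smul_measure
      ENNReal.ofReal_ne_top]
    refine Finset.sum_congr rfl fun x _ => ?_
    rw [integral_smul_measure, integral_dirac, ENNReal.toReal_ofReal (hw x), smul_eq_mul]
  have : IsProbabilityMeasure ν := ⟨by
    simp only [ν, Measure.coe_finsetSum, Finset.sum_apply, Measure.smul_apply, measure_univ,
      smul_eq_mul, mul_one]
    rw [← ENNReal.ofReal_sum_of_nonneg fun x _ => hw x, hw1, ENNReal.ofReal_one]⟩
  have h := hasSubgaussianMGF_of_mem_Icc (μ := ν) (X := f) (a := -1) (b := 1)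
    (measurable_of_finite f).aemeasurable (Filter.Eventually.of_forall fun x => abs_le.1 (hf x))
  have h2 := h.mgf_le t
  rw [mgf, hint, hint] at h2
  refine h2.trans (le_of_eq ?_)
  congr 1
  norm_num

variable {J : Type*} [Fintype J] [DecidableEq J]

lemma prod_weight_nonneg (hw : ∀ x, 0 ≤ w x) (x : J → X) : 0 ≤ ∏ k, w (x k) :=
  Finset.prod_nonneg fun k _ => hw (x k)

lemma sum_prod_weight (hw1 : ∑ x, w x = 1) : ∑ x : J → X, ∏ k, w (x k) = 1 := by
  have h := Finset.prod_univ_sum (fun _ : J => (Finset.univ : Finset X)) (fun _ x => w x)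
  rw [Fintype.piFinset_univ] at h
  rw [← h, Finset.prod_const, hw1, one_pow]

-- Chernoff's method with exponent `τ`, the optimum for the variance proxy `1` of values in `[-1,
-- 1]`.
open Classical in
lemma sum_upper_tail_le (hw : ∀ x, 0 ≤ w x) (hw1 : ∑ x, w x = 1) {f : X → ℝ}
    (hf : ∀ x, |f x| ≤ 1) {τ : ℝ} (hτ : 0 ≤ τ) :
    ∑ x : J → X with Fintype.card J * τ < ∑ k, (f (x k) - ∑ y, w y * f y), ∏ k, w (x k) ≤
      Real.exp (-(Fintype.card J * τ ^ 2 / 2)) := by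
  set a := ∑ y, w y * f y with ha
  set N : ℝ := (Fintype.card J : ℝ) with hN
  have h1 : ∀ x : J → X, (if N * τ < ∑ k, (f (x k) - a) then ∏ k, w (x k) else 0) ≤
      Real.exp (-(N * τ ^ 2)) * ∏ k, (w (x k) * Real.exp (τ * (f (x k) - a))) := by
    intro x
    have hp := prod_weight_nonneg hw x
    rw [Finset.prod_mul_distrib, ← Real.exp_sum, ← Finset.mul_sum, mul_left_comm, ← Real.exp_add]
    split_ifs with h
    · refine le_mul_of_one_le_right hp (Real.one_le_exp ?_)
      nlinarith
    · positivity
  rw [Finset.sum_filter]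
  refine (Finset.sum_le_sum fun x _ => h1 x).trans ?_
  have h := Finset.prod_univ_sum (fun _ : J => (Finset.univ : Finset X))
    (fun _ x => w x * Real.exp (τ * (f x - a)))
  rw [Fintype.piFinset_univ] at h
  rw [← Finset.mul_sum, ← h, Finset.prod_const, Finset.card_univ]
  have h2 : (∑ x, w x * Real.exp (τ * (f x - a))) ^ Fintype.card J ≤
      Real.exp (τ ^ 2 / 2) ^ Fintype.card J :=
    pow_le_pow_left₀ (Finset.sum_nonneg fun x _ => mul_nonneg (hw x) (Real.exp_pos _).le)
      (sum_mul_exp_le hw hw1 hf τ) _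
  refine (mul_le_mul_of_nonneg_left h2 (Real.exp_pos _).le).trans (le_of_eq ?_)
  rw [← Real.exp_nat_mul, ← Real.exp_add]
  congr 1
  rw [← hN]
  ring

open Classical in
/-- Hoeffding's inequality for the average of independent samples from a finite distribution. -/
lemma sum_tail_le [Nonempty J] (hw : ∀ x, 0 ≤ w x) (hw1 : ∑ x, w x = 1) {f : X → ℝ}
    (hf : ∀ x, |f x| ≤ 1) {τ : ℝ} (hτ : 0 ≤ τ) :
    ∑ x : J → X with τ < |(∑ k, f (x k)) / Fintype.card J - ∑ y, w y * f y|, ∏ k, w (x k) ≤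
      2 * Real.exp (-(Fintype.card J * τ ^ 2 / 2)) := by
  have h1 := sum_upper_tail_le (J := J) hw hw1 hf hτ
  have h2 := sum_upper_tail_le (J := J) hw hw1 (f := fun x => -f x) (fun x => by
    rw [abs_neg]; exact hf x) hτ
  have hN : (0 : ℝ) < Fintype.card J := by exact_mod_cast Fintype.card_pos
  simp only [mul_neg, Finset.sum_neg_distrib] at h2
  set a := ∑ y, w y * f y
  clear_value a
  rw [two_mul]
  refine le_trans ?_ (add_le_add h1 h2)
  simp only [Finset.sum_filter]
  rw [← Finset.sum_add_distrib]
  refine Finset.sum_le_sum fun x _ => ?_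
  have hp := prod_weight_nonneg hw x
  have hs : ∑ k, (f (x k) - a) = Fintype.card J * ((∑ k, f (x k)) / Fintype.card J - a) := by
    rw [Finset.sum_sub_distrib, mul_sub, mul_div_cancel₀ _ hN.ne']
    simp
  have hs' : ∑ k, (-f (x k) - -a) = -(Fintype.card J * ((∑ k, f (x k)) / Fintype.card J - a)) := by
    rw [← hs, ← Finset.sum_neg_distrib]
    exact Finset.sum_congr rfl fun k _ => by ring
  rw [hs, hs']
  by_cases h : τ < |(∑ k, f (x k)) / Fintype.card J - a|
  · rw [if_pos h]
    rcases lt_abs.1 h with h | h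
    · rw [if_pos (mul_lt_mul_of_pos_left h hN)]
      split_ifs <;> linarith
    · have : Fintype.card J * τ < -(Fintype.card J * ((∑ k, f (x k)) / Fintype.card J - a)) := by
        rw [← mul_neg]; exact mul_lt_mul_of_pos_left h hN
      rw [if_pos this]
      split_ifs <;> linarith
  · rw [if_neg h]
    split_ifs <;> linarith

open Classical in
lemma one_sub_le_sum_forall {m : ℕ} {W : X → ℝ} (hW : ∀ x, 0 ≤ W x) (hW1 : ∑ x, W x = 1)
    {B : Fin m → X → Prop} {δ : ℝ} (hB : ∀ i, ∑ x with B i x, W x ≤ δ) :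
    1 - m * δ ≤ ∑ x with ∀ i, ¬ B i x, W x := by
  have h1 : ∑ x with ¬ ∀ i, ¬ B i x, W x ≤ ∑ i, ∑ x with B i x, W x := by
    simp only [Finset.sum_filter]
    rw [Finset.sum_comm]
    refine Finset.sum_le_sum fun x _ => ?_
    have hnn : ∀ i ∈ Finset.univ, 0 ≤ if B i x then W x else 0 := fun i _ => by
      split_ifs
      · exact hW x
      · exact le_rfl
    by_cases h : ∃ i, B i x
    · rw [if_pos (by push Not; exact h)]
      obtain ⟨i, hi⟩ := h
      refine le_trans ?_ (Finset.single_le_sum hnn (Finset.mem_univ i))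
      rw [if_pos hi]
    · rw [if_neg (by push Not; exact not_exists.1 h)]
      exact Finset.sum_nonneg hnn
  have h2 : ∑ i, ∑ x with B i x, W x ≤ m * δ := by
    refine (Finset.sum_le_sum fun i _ => hB i).trans ?_
    simp
  have h3 := Finset.sum_filter_add_sum_filter_not Finset.univ (fun x => ∀ i, ¬ B i x) W
  rw [hW1] at h3
  linarith

open Classical in
/-- Simultaneous concentration of finitely many averages. -/
lemma one_sub_le_sum_averages [Nonempty J] {m : ℕ} (hw : ∀ x, 0 ≤ w x) (hw1 : ∑ x, w x = 1)
    {f : Fin m → X → ℝ} (hf : ∀ i x, |f i x| ≤ 1) {τ : ℝ} (hτ : 0 ≤ τ) :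
    1 - m * (2 * Real.exp (-(Fintype.card J * τ ^ 2 / 2))) ≤
      ∑ x : J → X with ∀ i, |(∑ k, f i (x k)) / Fintype.card J - ∑ y, w y * f i y| ≤ τ,
        ∏ k, w (x k) := by
  have h := one_sub_le_sum_forall (m := m) (prod_weight_nonneg (J := J) hw) (sum_prod_weight hw1)
    (B := fun i x => τ < |(∑ k, f i (x k)) / Fintype.card J - ∑ y, w y * f i y|)
    (fun i => sum_tail_le hw hw1 (hf i) hτ)
  simpa only [not_lt] using h

end Concentration

/-! ### Two-stage estimation of Pauli expectations -/

section Protocols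

open scoped Kronecker

variable {n : ℕ}

lemma exists_isDensity (n : ℕ) : ∃ σ : Op n, IsDensity σ :=
  ⟨gibbs (m := 0) Fin.elim0 0, isDensity_gibbs (fun i => i.elim0) 0⟩

lemma copies_eq_piKron (N : ℕ) (ρ : Op n) : copies N ρ = piKron fun _ => ρ := rfl

/-- `N = 2 N₁ + N₂` systems as `N₁` pairs and `N₂` single systems. -/
def splitEquiv {N N₁ N₂ : ℕ} (D : Type*) (hN : N = N₁ + N₁ + N₂) :
    (Fin N → D) ≃ (Fin N₁ → D × D) × (Fin N₂ → D) :=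
  (Equiv.arrowCongr ((finCongr hN).trans (finSumFinEquiv.symm.trans
    (Equiv.sumCongr finSumFinEquiv.symm (Equiv.refl _)))) (Equiv.refl D)).trans
  ((Equiv.sumArrowEquivProdArrow _ _ D).trans
    (Equiv.prodCongr ((Equiv.sumArrowEquivProdArrow _ _ D).trans
      (Equiv.arrowProdEquivProdArrow _ _ _).symm) (Equiv.refl _)))

lemma copies_eq_submatrix {N N₁ N₂ : ℕ} (hN : N = N₁ + N₁ + N₂) (ρ : Op n) :
    copies N ρ = (piKron (fun _ : Fin N₁ => ρ ⊗ₖ ρ) ⊗ₖ piKron fun _ : Fin N₂ => ρ).submatrix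
      (splitEquiv (Qubits n) hN) (splitEquiv (Qubits n) hN) := by
  ext x y
  rw [copies, Matrix.of_apply, ← Equiv.prod_comp ((finCongr hN).trans (finSumFinEquiv.symm.trans
    (Equiv.sumCongr finSumFinEquiv.symm (Equiv.refl _)))).symm, Fintype.prod_sum_type,
    Fintype.prod_sum_type, ← Finset.prod_mul_distrib]
  rfl

open Classical in
/-- Bell sampling determines the magnitudes of Pauli expectations, and twirling a state with these
magnitudes determines their signs. -/
theorem exists_protocol_pauli {m N N₁ N₂ : ℕ} (hN : N = N₁ + N₁ + N₂) (hN₁ : 0 < N₁) (hN₂ : 0 < N₂)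
    (p : Fin m → Fin n → Fin 4) {κ : ℝ} (hκ : 0 < κ) :
    ∃ M : Protocol n N m, ∀ ρ : Op n, IsDensity ρ →
      1 - m * (2 * Real.exp (-(N₁ * (κ ^ 2 / 4) ^ 2 / 2))) -
          m * (2 * Real.exp (-(N₂ * (κ ^ 2 / 4) ^ 2 / 2))) ≤
        M.successProb (fun i => pauliString (p i)) κ ρ := by
  have : Nonempty (Fin N₁) := ⟨⟨0, hN₁⟩⟩
  have : Nonempty (Fin N₂) := ⟨⟨0, hN₂⟩⟩
  set τ := κ ^ 2 / 4 with hτ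
  have hτ0 : 0 ≤ τ := by positivity
  let avg₁ : (Fin N₁ → Fin n → Fin 4) → Fin m → ℝ := fun x i =>
    (∑ k, stringTransposeSign (p i) * stringSign (p i) (x k)) / N₁
  let avg₂ : (Fin N₂ → Fin n → Fin 4) → Fin m → ℝ := fun y i =>
    (∑ k, stringSign (p i) (y k)) / N₂
  -- A state fitting the first-stage record, picked classically. When the record is accurate, `ρ`
  -- itself fits, so the chosen `σ` does too, and the squares for `σ` and `ρ` differ by at most `2τ
  -- = κ² / 2`. Otherwise any state will do.
  have hex : ∀ x, ∃ σ : Op n, IsDensity σ ∧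
      ((∃ σ' : Op n, IsDensity σ' ∧ ∀ i, |avg₁ x i - expVal (pauliString (p i)) σ' ^ 2| ≤ τ) →
        ∀ i, |avg₁ x i - expVal (pauliString (p i)) σ ^ 2| ≤ τ) := by
    intro x
    by_cases h : ∃ σ' : Op n, IsDensity σ' ∧ ∀ i, |avg₁ x i - expVal (pauliString (p i)) σ' ^ 2| ≤ τ
    · obtain ⟨σ, h1, h2⟩ := h
      exact ⟨σ, h1, fun _ => h2⟩
    · obtain ⟨σ, h1⟩ := exists_isDensity n
      exact ⟨σ, h1, fun h' => absurd h' h⟩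
  choose s hs hs' using hex
  -- Below the threshold `⟨P⟩_ρ² ≤ κ² / 2 + 2τ = κ²`, so `0` is accurate enough. Above it, division
  -- by `⟨P⟩_σ` is safe because `τ ≤ κ |⟨P⟩_σ|`.
  let est : (Fin N₁ → Fin n → Fin 4) × (Fin N₂ → Fin n → Fin 4) → Fin m → ℝ := fun z i =>
    if expVal (pauliString (p i)) (s z.1) ^ 2 ≤ κ ^ 2 / 2 then 0
    else avg₂ z.2 i / expVal (pauliString (p i)) (s z.1)
  refine ⟨((((bell n).pi (Fin N₁)).adaptive fun x => (twirl (s x) (hs x)).pi (Fin N₂)).reindex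
    (splitEquiv (Qubits n) hN)).toProtocol est, fun ρ hρ => ?_⟩
  have hρρ : (ρ ⊗ₖ ρ).PosSemidef := hρ.1.kronecker hρ.1
  have htr : (ρ ⊗ₖ ρ).trace = 1 := by rw [Matrix.trace_kronecker, hρ.2, one_mul]
  rw [POVM.successProb_toProtocol]
  simp only [copies_eq_submatrix hN, POVM.prob_reindex,
    POVM.prob_adaptive _ _ (posSemidef_piKron fun _ => hρρ) (posSemidef_piKron fun _ => hρ.1),
    POVM.prob_pi _ hρρ, POVM.prob_pi _ hρ.1]
  have w1 := (bell n).prob_nonneg hρρ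
  have w2 := fun x => (twirl (s x) (hs x)).prob_nonneg hρ.1
  have hfirst := one_sub_le_sum_averages (J := Fin N₁) w1 ((bell n).sum_prob htr)
    (f := fun i q => stringTransposeSign (p i) * stringSign (p i) q) (fun i q => by
      rw [abs_mul, abs_stringSign, abs_stringTransposeSign, one_mul]) hτ0
  -- Transposition contributes the same sign that is built into the estimator; the two cancel and
  -- the mean is a true square.
  have hmean : ∀ i, ∑ q, (bell n).prob (ρ ⊗ₖ ρ) q *
      (stringTransposeSign (p i) * stringSign (p i) q) = expVal (pauliString (p i)) ρ ^ 2 := by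
    intro i
    simp only [prob_bell hρ]
    have h := sum_stringSign_mul_prob_twirl hρ.transpose hρ (p i)
    rw [expVal_transpose] at h
    have h1 : stringTransposeSign (p i) * stringTransposeSign (p i) = 1 := by
      rw [← abs_mul_abs_self, abs_stringTransposeSign, one_mul]
    calc _ = stringTransposeSign (p i) *
          ∑ q, (twirl ρᵀ hρ.transpose).prob ρ q * stringSign (p i) q := by
            rw [Finset.mul_sum]
            exact Finset.sum_congr rfl fun q _ => by ring
      _ = _ := by rw [h]; linear_combination expVal (pauliString (p i)) ρ ^ 2 * h1
  simp only [hmean] at hfirst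
  have hsecond := fun x => one_sub_le_sum_averages (J := Fin N₂) (w2 x)
    ((twirl (s x) (hs x)).sum_prob hρ.2)
    (f := fun i q => stringSign (p i) q) (fun i q => (abs_stringSign _ _).le) hτ0
  simp only [sum_stringSign_mul_prob_twirl (hs _) hρ] at hsecond
  rw [Fintype.card_fin] at hfirst
  simp only [Fintype.card_fin (n := N₂)] at hsecond
  have hgood : ∀ x y, (∀ i, |avg₁ x i - expVal (pauliString (p i)) ρ ^ 2| ≤ τ) →
      (∀ i, |avg₂ y i - expVal (pauliString (p i)) (s x) * expVal (pauliString (p i)) ρ| ≤ τ) →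
      ∀ i, |est (x, y) i - expVal (pauliString (p i)) ρ| ≤ κ := by
    intro x y h1 h2 i
    have h3 := abs_le.1 (hs' x ⟨ρ, hρ, h1⟩ i)
    have h1 := abs_le.1 (h1 i)
    have h2 := h2 i
    simp only [est]
    set a := expVal (pauliString (p i)) (s x)
    set r := expVal (pauliString (p i)) ρ
    split_ifs with h
    · rw [zero_sub, abs_neg]
      refine abs_le_of_sq_le_sq ?_ hκ.le
      linarith
    · push Not at h
      have ha : a ≠ 0 := by
        rintro h0
        rw [h0] at h
        have : 0 < κ ^ 2 := by positivity
        norm_num at h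
        linarith
      have h4 : avg₂ y i / a - r = (avg₂ y i - a * r) / a := by field_simp
      rw [h4, abs_div, div_le_iff₀ (abs_pos.2 ha)]
      refine h2.trans ?_
      have h5 : κ / 4 ≤ |a| := by
        refine abs_le_of_sq_le_sq' ?_ (abs_nonneg a) |>.2
        rw [sq_abs]
        nlinarith
      nlinarith
  set ε₁ := m * (2 * Real.exp (-(N₁ * τ ^ 2 / 2)))
  set ε₂ := m * (2 * Real.exp (-(N₂ * τ ^ 2 / 2))) with hε₂
  have hε₂0 : 0 ≤ ε₂ := by positivity
  set P₁ : (Fin N₁ → Fin n → Fin 4) → ℝ := fun x => ∏ k, (bell n).prob (ρ ⊗ₖ ρ) (x k) with hP₁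
  set P₂ : (Fin N₁ → Fin n → Fin 4) → (Fin N₂ → Fin n → Fin 4) → ℝ :=
    fun x y => ∏ k, (twirl (s x) (hs x)).prob ρ (y k) with hP₂
  have hP₁0 : ∀ x, 0 ≤ P₁ x := prod_weight_nonneg w1
  have hP₂0 : ∀ x y, 0 ≤ P₂ x y := fun x => prod_weight_nonneg (w2 x)
  set A := ∑ x with ∀ i, |avg₁ x i - expVal (pauliString (p i)) ρ ^ 2| ≤ τ, P₁ x with hA
  have hA1 : A ≤ 1 := by
    rw [← sum_prod_weight (J := Fin N₁) ((bell n).sum_prob htr)]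
    exact Finset.sum_le_sum_of_subset_of_nonneg (Finset.filter_subset _ _) fun x _ _ => hP₁0 x
  have hfirst' : 1 - ε₁ ≤ A := hfirst
  have hmain : A * (1 - ε₂) ≤ ∑ z : (Fin N₁ → Fin n → Fin 4) × (Fin N₂ → Fin n → Fin 4) with
      ∀ i, |est z i - expVal (pauliString (p i)) ρ| ≤ κ, P₁ z.1 * P₂ z.1 z.2 := by
    rw [hA, Finset.sum_mul, Finset.sum_filter, Finset.sum_filter, Fintype.sum_prod_type]
    refine Finset.sum_le_sum fun x _ => ?_
    have hnn : ∀ y, 0 ≤ if ∀ i, |est (x, y) i - expVal (pauliString (p i)) ρ| ≤ κ then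
        P₁ x * P₂ x y else 0 := fun y => by
      split_ifs
      · exact mul_nonneg (hP₁0 x) (hP₂0 x y)
      · exact le_rfl
    split_ifs with h
    · refine (mul_le_mul_of_nonneg_left (hsecond x) (hP₁0 x)).trans ?_
      rw [Finset.mul_sum, Finset.sum_filter]
      refine Finset.sum_le_sum fun y _ => ?_
      split_ifs with h1 h2 h2
      · exact le_rfl
      · exact absurd (hgood x y h h1) h2
      · exact mul_nonneg (hP₁0 x) (hP₂0 x y)
      · exact le_rfl
    · exact Finset.sum_nonneg fun y _ => hnn y
  refine le_trans ?_ hmain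
  -- `A (1 - ε₂) ≥ A - ε₂ ≥ 1 - ε₁ - ε₂`, using `A ≤ 1`.
  nlinarith

end Protocols

/-! ### Copy count, including very few copies -/

section SmallProtocols

variable {n : ℕ}

/-- The two-outcome measurement of a Pauli operator. -/
noncomputable def pauliPOVM (p : Fin n → Fin 4) : POVM (Qubits n) (Fin 2) where
  effect x := (2 : ℂ)⁻¹ • (1 + (((-1) ^ (x : ℕ) : ℝ) : ℂ) • pauliString p)
  posSemidef x := by
    set s : ℝ := (-1) ^ (x : ℕ) with hs
    have hs2 : (s : ℂ) * s = 1 := by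
      rw [← Complex.ofReal_mul, hs, ← pow_add, ← two_mul, pow_mul]
      simp
    set A : Op n := (2 : ℂ)⁻¹ • (1 + (s : ℂ) • pauliString p) with hA
    have hherm : Aᴴ = A := by
      rw [hA, Matrix.conjTranspose_smul, Matrix.conjTranspose_add, Matrix.conjTranspose_smul,
        (pauliString_isHermitian p).eq]
      simp
    have hidem : Aᴴ * A = A := by
      rw [hherm, hA]
      simp only [Matrix.smul_mul, Matrix.mul_smul, Matrix.add_mul, Matrix.mul_add, Matrix.one_mul,
        Matrix.mul_one, pauliString_mul_self, smul_add, smul_smul]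
      have e : (2 : ℂ)⁻¹ * s * (2⁻¹ * s) = 2⁻¹ * 2⁻¹ := by linear_combination 2⁻¹ * 2⁻¹ * hs2
      rw [e]
      module
    rw [← hidem]
    exact Matrix.posSemidef_conjTranspose_mul_self A
  sum_effect := by
    rw [Fin.sum_univ_two]
    simp only [Fin.val_zero, Fin.val_one, pow_zero, pow_one]
    push_cast
    module

lemma sum_prob_pauliPOVM (p : Fin n → Fin 4) {ρ : Op n} (hρ : IsDensity ρ) :
    ∑ x : Fin 2, (pauliPOVM p).prob ρ x * (-1) ^ (x : ℕ) = expVal (pauliString p) ρ := by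
  have h : ∀ x : Fin 2, (pauliPOVM p).prob ρ x =
      2⁻¹ * (1 + (-1) ^ (x : ℕ) * expVal (pauliString p) ρ) := by
    intro x
    have h2 : ((pauliPOVM p).effect x * ρ).trace =
        ((2⁻¹ * (1 + (-1) ^ (x : ℕ) * expVal (pauliString p) ρ) : ℝ) : ℂ) := by
      simp only [pauliPOVM, Matrix.smul_mul, Matrix.trace_smul, Matrix.add_mul, Matrix.trace_add,
        Matrix.one_mul, hρ.2, smul_eq_mul]
      rw [Matrix.trace_mul_comm (pauliString p), ← ofReal_expVal (pauliString_isHermitian p) hρ]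
      push_cast
      ring
    rw [POVM.prob, h2, Complex.ofReal_re]
  simp only [h, Fin.sum_univ_two, Fin.val_zero, Fin.val_one, pow_zero, pow_one]
  ring

lemma abs_expVal_pauliString_le (p : Fin n → Fin 4) {ρ : Op n} (hρ : IsDensity ρ) :
    |expVal (pauliString p) ρ| ≤ 1 := by
  rw [← sum_prob_pauliPOVM p hρ]
  refine ((Finset.abs_sum_le_sum_abs _ _).trans (Finset.sum_le_sum fun x _ => ?_)).trans
    ((pauliPOVM p).sum_prob hρ.2).le
  rw [abs_mul, abs_pow, abs_neg, abs_one, one_pow, mul_one,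
    abs_of_nonneg ((pauliPOVM p).prob_nonneg hρ.1 x)]

open Classical in
/-- Averaging repeated measurements of a single Pauli operator. -/
theorem exists_protocol_average {N : ℕ} (hN : 0 < N) (p : Fin 1 → Fin n → Fin 4) {κ : ℝ}
    (hκ : 0 < κ) :
    ∃ M : Protocol n N 1, ∀ ρ : Op n, IsDensity ρ →
      1 - 2 * Real.exp (-(N * κ ^ 2 / 2)) ≤ M.successProb (fun i => pauliString (p i)) κ ρ := by
  have : Nonempty (Fin N) := ⟨⟨0, hN⟩⟩
  refine ⟨((pauliPOVM (p 0)).pi (Fin N)).toProtocol fun x _ =>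
    (∑ k, (-1 : ℝ) ^ (x k : ℕ)) / Fintype.card (Fin N), fun ρ hρ => ?_⟩
  rw [POVM.successProb_toProtocol]
  simp only [copies_eq_piKron, POVM.prob_pi _ hρ.1]
  have h := one_sub_le_sum_averages (J := Fin N) (m := 1) ((pauliPOVM (p 0)).prob_nonneg hρ.1)
    ((pauliPOVM (p 0)).sum_prob hρ.2) (f := fun _ x => (-1) ^ (x : ℕ)) (fun _ x => by
      rw [abs_pow, abs_neg, abs_one, one_pow]) hκ.le
  simp only [sum_prob_pauliPOVM _ hρ] at h
  have h1 : ∀ i : Fin 1, p i = p 0 := fun i => by rw [Subsingleton.elim i 0]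
  simp only [h1]
  rw [Fintype.card_fin] at h ⊢
  simpa using h

open Classical in
/-- Guessing from a finite list, without looking at the state. -/
theorem exists_protocol_guess (N : ℕ) {m K : ℕ} (hK : 0 < K) (g : Fin K → ℝ)
    (H : Fin m → Op n) {κ : ℝ} (hg : ∀ ρ : Op n, IsDensity ρ →
      ∃ x, ∀ i, |g x - expVal (H i) ρ| ≤ κ) :
    ∃ M : Protocol n N m, ∀ ρ : Op n, IsDensity ρ → 1 / (K : ℝ) ≤ M.successProb H κ ρ := by
  have hK' : (K : ℂ) ≠ 0 := by exact_mod_cast hK.ne'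
  let E : POVM (Fin N → Qubits n) (Fin K) :=
    { effect := fun _ => (((1 / K : ℝ)) : ℂ) • 1
      posSemidef := fun _ => Matrix.PosSemidef.one.smul (by
        rw [Complex.zero_le_real]; positivity)
      sum_effect := by
        rw [Finset.sum_const, Finset.card_univ, Fintype.card_fin, ← Nat.cast_smul_eq_nsmul ℂ,
          smul_smul]
        push_cast
        rw [mul_one_div_cancel hK', one_smul] }
  refine ⟨E.toProtocol fun x _ => g x, fun ρ hρ => ?_⟩
  rw [POVM.successProb_toProtocol]
  obtain ⟨x, hx⟩ := hg ρ hρ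
  have hprob : ∀ x, E.prob (copies N ρ) x = 1 / K := by
    intro x
    rw [POVM.prob]
    simp only [E, Matrix.smul_mul, Matrix.one_mul, Matrix.trace_smul]
    rw [copies_eq_piKron, trace_piKron]
    simp [hρ.2]
  simp only [hprob]
  exact Finset.single_le_sum (f := fun _ : Fin K => 1 / (K : ℝ)) (fun _ _ => by positivity)
    (Finset.mem_filter.2 ⟨Finset.mem_univ x, hx⟩)

lemma exists_grid_point {K : ℕ} (hK : 0 < K) {r : ℝ} (hr : |r| ≤ 1) :
    ∃ x : Fin K, |(-1 + (2 * (x : ℝ) + 1) / K) - r| ≤ 1 / K := by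
  have hK' : (0 : ℝ) < K := by exact_mod_cast hK
  obtain ⟨h1, h2⟩ := abs_le.1 hr
  have hy0 : 0 ≤ (r + 1) * K / 2 := by
    have : 0 ≤ r + 1 := by linarith
    positivity
  have e : ∀ x : ℝ, (-1 + (2 * x + 1) / K) - r = (2 * x + 1 - (r + 1) * K) / K := by
    intro x; field_simp; ring
  have key : ∀ x : ℝ, |2 * x + 1 - (r + 1) * K| ≤ 1 → |(-1 + (2 * x + 1) / K) - r| ≤ 1 / K := by
    intro x hx
    rw [e, abs_div, abs_of_pos hK']
    exact div_le_div_of_nonneg_right hx hK'.le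
  by_cases hlt : ⌊(r + 1) * K / 2⌋₊ < K
  · refine ⟨⟨_, hlt⟩, key _ ?_⟩
    have f1 := Nat.floor_le hy0
    have f2 := Nat.lt_floor_add_one ((r + 1) * K / 2)
    rw [abs_le]
    constructor <;> simp only <;> linarith
  · refine ⟨⟨K - 1, by omega⟩, key _ ?_⟩
    push Not at hlt
    have f1 := (Nat.le_floor_iff hy0).1 hlt
    have f2 : (r + 1) * K ≤ 2 * K := mul_le_mul_of_nonneg_right (by linarith) hK'.le
    have f3 : ((K - 1 : ℕ) : ℝ) = K - 1 := by rw [Nat.cast_sub hK]; simp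
    simp only [f3]
    rw [abs_le]
    constructor <;> linarith

/-- The number of preparations that suffices to estimate `m` Pauli operators. -/
theorem exists_protocol {m : ℕ} (hm : 0 < m) (p : Fin m → Fin n → Fin 4) {κ π : ℝ} (hκ : 0 < κ)
    (hπ0 : 0 < π) (hπ1 : π < 1) {N : ℕ} (hN : 768 * (1 / κ ^ 4) * Real.log (m / (1 - π)) ≤ N) :
    ∃ M : Protocol n N m, ∀ ρ : Op n, IsDensity ρ →
      π ≤ M.successProb (fun i => pauliString (p i)) κ ρ := by
  have hm' : (1 : ℝ) ≤ m := by exact_mod_cast hm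
  have hδ : 0 < 1 - π := by linarith
  set L := Real.log (m / (1 - π)) with hL
  have hexpL : Real.exp (-L) = (1 - π) / m := by
    rw [Real.exp_neg, hL, Real.exp_log (by positivity), inv_div]
  have hNL : 768 * L ≤ N * κ ^ 4 := by
    have h := mul_le_mul_of_nonneg_right hN (by positivity : 0 ≤ κ ^ 4)
    have h2 : 768 * (1 / κ ^ 4) * L * κ ^ 4 = 768 * L := by field_simp
    linarith
  rcases le_or_gt 1 κ with hκ1 | hκ1
  · obtain ⟨M, hM⟩ := exists_protocol_guess N one_pos (fun _ : Fin 1 => (0 : ℝ))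
      (fun i => pauliString (p i)) (κ := κ) (fun ρ hρ => ⟨0, fun i => by
        rw [zero_sub, abs_neg]
        exact (abs_expVal_pauliString_le (p i) hρ).trans hκ1⟩)
    exact ⟨M, fun ρ hρ => hπ1.le.trans (by simpa using hM ρ hρ)⟩
  have hκ4 : κ ^ 4 ≤ 1 := pow_le_one₀ hκ.le hκ1.le
  -- For `m = 1` the logarithm can be arbitrarily small, leaving too few copies for concentration
  -- bounds with prefactors; for `m ≥ 2` it is at least `1/2`.
  rcases Nat.lt_or_ge m 2 with hm2 | hm2
  · obtain rfl : m = 1 := by omega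
    simp only [Nat.cast_one, div_one] at hexpL
    have hκ42 : κ ^ 4 ≤ κ ^ 2 := pow_le_pow_of_le_one hκ.le hκ1.le (by norm_num)
    have hNκ : (N : ℝ) * κ ^ 4 ≤ N * κ ^ 2 := mul_le_mul_of_nonneg_left hκ42 (Nat.cast_nonneg N)
    by_cases hlarge : 4 ≤ (N : ℝ) * κ ^ 2
    · have hN0 : 0 < N := by
        rcases Nat.eq_zero_or_pos N with h | h
        · rw [h] at hlarge; norm_num at hlarge
        · exact h
      obtain ⟨M, hM⟩ := exists_protocol_average hN0 p hκ
      refine ⟨M, fun ρ hρ => le_trans ?_ (hM ρ hρ)⟩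
      have h1 : 2 * Real.exp (-(N * κ ^ 2 / 2)) ≤ Real.exp (-L) := by
        have h2 : (2 : ℝ) ≤ Real.exp 1 := by linarith [Real.add_one_le_exp (1 : ℝ)]
        calc 2 * Real.exp (-(N * κ ^ 2 / 2)) ≤ Real.exp 1 * Real.exp (-(N * κ ^ 2 / 2)) :=
              mul_le_mul_of_nonneg_right h2 (Real.exp_pos _).le
          _ = Real.exp (1 + -(N * κ ^ 2 / 2)) := (Real.exp_add _ _).symm
          _ ≤ Real.exp (-L) := Real.exp_le_exp.2 (by linarith)
      linarith
    -- Few copies mean a small target probability: `π ≤ L ≤ 4κ / 768`, while a blind guess on a grid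
    -- of `⌈1/κ⌉` points succeeds with probability at least `κ / 2`.
    · push Not at hlarge
      set K := ⌈1 / κ⌉₊ with hK
      have hK0 : 0 < K := Nat.ceil_pos.2 (by positivity)
      have hK' : (0 : ℝ) < K := by exact_mod_cast hK0
      have hK1 : 1 / κ ≤ K := Nat.le_ceil _
      have hK2 : (K : ℝ) ≤ 2 / κ := by
        have h1 := Nat.ceil_lt_add_one (by positivity : 0 ≤ 1 / κ)
        have h2 : 1 ≤ 1 / κ := by rw [le_div_iff₀ hκ]; linarith
        have h3 : 2 / κ = 1 / κ + 1 / κ := by ring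
        linarith
      obtain ⟨M, hM⟩ := exists_protocol_guess N hK0
        (fun x : Fin K => -1 + (2 * (x : ℝ) + 1) / K) (fun i => pauliString (p i)) (κ := κ)
        (fun ρ hρ => by
          obtain ⟨x, hx⟩ := exists_grid_point hK0 (abs_expVal_pauliString_le (p 0) hρ)
          refine ⟨x, fun i => ?_⟩
          rw [Subsingleton.elim i 0]
          refine hx.trans ?_
          rw [div_le_iff₀ hK']
          rw [div_le_iff₀ hκ] at hK1
          linarith)
      refine ⟨M, fun ρ hρ => le_trans ?_ (hM ρ hρ)⟩
      have h1 : π ≤ L := by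
        have := Real.add_one_le_exp (-L)
        linarith
      have h2 : κ / 2 ≤ 1 / K := by
        rw [le_div_iff₀ hK']
        rw [le_div_iff₀ hκ] at hK2
        linarith
      have h3 : (N : ℝ) * κ ^ 4 ≤ 4 * κ := by
        have e : (N : ℝ) * κ ^ 4 = (N * κ ^ 2) * κ ^ 2 := by ring
        rw [e]
        nlinarith [sq_nonneg κ]
      linarith
  · have hm2' : (2 : ℝ) ≤ m := by exact_mod_cast hm2
    have hLlow : 1 / 2 ≤ L := by
      have h1 : Real.exp (-L) ≤ 1 / 2 := by
        rw [hexpL, div_le_iff₀ (by linarith)]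
        linarith
      have := Real.add_one_le_exp (-L)
      linarith
    have hNbig : (4 : ℝ) ≤ N := by
      have : (N : ℝ) * κ ^ 4 ≤ N := mul_le_of_le_one_right (Nat.cast_nonneg N) hκ4
      linarith
    have hNbig' : 4 ≤ N := by exact_mod_cast hNbig
    -- A pair uses two copies, so thirds balance the stages; the floors cost at most a factor two,
    -- hence `N ≤ 6 N₁`.
    set N₁ := N / 3 with hN₁
    set N₂ := N - (N₁ + N₁) with hN₂
    have e1 : N = N₁ + N₁ + N₂ := by omega
    have e2 : N ≤ 6 * N₁ := by omega
    have e3 : N₁ ≤ N₂ := by omega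
    obtain ⟨M, hM⟩ := exists_protocol_pauli e1 (by omega) (by omega) p hκ
    refine ⟨M, fun ρ hρ => le_trans ?_ (hM ρ hρ)⟩
    -- Here `768 = 6 * 32 * 4`: `6` from `N ≤ 6 k`, `32` from `(κ²/4)² / 2`, and `4` from the power
    -- of `exp (-L) = (1 - π) / m` that absorbs the prefactor `4 m`.
    have hbound : ∀ k : ℕ, N ≤ 6 * k →
        Real.exp (-(k * (κ ^ 2 / 4) ^ 2 / 2)) ≤ Real.exp (-L) ^ 4 := by
      intro k hk
      rw [← Real.exp_nat_mul]
      apply Real.exp_le_exp.2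
      have hk' : (N : ℝ) ≤ 6 * k := by exact_mod_cast hk
      have h1 : (N : ℝ) * κ ^ 4 ≤ 6 * k * κ ^ 4 :=
        mul_le_mul_of_nonneg_right hk' (by positivity)
      push_cast
      linarith
    have b1 := hbound N₁ e2
    have b2 := hbound N₂ (by omega)
    rw [hexpL] at b1 b2
    have h4 : m * (4 * ((1 - π) / m) ^ 4) ≤ 1 - π := by
      have h5 : m * (4 * ((1 - π) / m) ^ 4) = (1 - π) * (4 * ((1 - π) / m) ^ 3) := by
        field_simp
      rw [h5]
      refine mul_le_of_le_one_right hδ.le ?_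
      have h6 : (1 - π) / m ≤ 1 / 2 := by
        rw [div_le_iff₀ (by linarith)]
        linarith
      have h7 : ((1 - π) / m) ^ 3 ≤ (1 / 2) ^ 3 := pow_le_pow_left₀ (by positivity) h6 3
      norm_num at h7 ⊢
      linarith
    have c1 := mul_le_mul_of_nonneg_left b1 (by linarith : (0 : ℝ) ≤ m)
    have c2 := mul_le_mul_of_nonneg_left b2 (by linarith : (0 : ℝ) ≤ m)
    linarith

end SmallProtocols

/-! ### Success over all adaptive rounds -/

section Rounds

variable {n N m : ℕ} {H : Fin m → Op n} {κ : ℝ}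
  {Ω : Type*} [mΩ : MeasurableSpace Ω] {μ : Measure Ω} [IsProbabilityMeasure μ] {ℱ : Filtration ℕ mΩ}
  {θ : ℕ → Ω → EuclideanSpace ℝ (Fin m)}

/-- Being good is a closed condition on the parameters, so it is decided by the information at time
`t`. -/
lemma measurableSet_good (hH : ∀ i, (H i).IsHermitian) (M : Protocol n N m) (t : ℕ)
    (hθ : StronglyMeasurable[ℱ t] (θ t)) (x : Fin M.numOutcomes) :
    MeasurableSet[ℱ t] {ω | M.Good H κ (gibbs H (θ t ω)) x} := by
  have hcl : IsClosed {v : EuclideanSpace ℝ (Fin m) | M.Good H κ (gibbs H v) x} := by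
    simp only [Protocol.Good, Set.ofPred_forall]
    exact isClosed_iInter fun i => isClosed_le
      ((continuous_const.sub (continuous_expVal_gibbs hH (H i))).abs) continuous_const
  exact hθ.measurable hcl.measurableSet

/-- One more round multiplies the probability of success by at least the worst-case success
probability of the protocol. -/
lemma mul_measureReal_le (hH : ∀ i, (H i).IsHermitian) (M : Protocol n N m) {π : ℝ}
    (hM : ∀ ρ : Op n, IsDensity ρ → π ≤ M.successProb H κ ρ) {o : ℕ → Ω → Fin M.numOutcomes} {t : ℕ}
    (hθ : StronglyMeasurable[ℱ t] (θ t)) (ho : Measurable[ℱ (t + 1)] (o t))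
    (hlaw : ∀ x, μ[Set.indicator {ω | o t ω = x} (fun _ => (1 : ℝ)) | ℱ t] =ᵐ[μ]
      fun ω => M.prob (gibbs H (θ t ω)) x)
    {A : Set Ω} (hA : MeasurableSet[ℱ t] A) :
    π * μ.real A ≤ μ.real (A ∩ {ω | M.Good H κ (gibbs H (θ t ω)) (o t ω)}) := by
  classical
  set G : Fin M.numOutcomes → Set Ω := fun x => {ω | M.Good H κ (gibbs H (θ t ω)) x} with hG
  have hGm : ∀ x, MeasurableSet[ℱ t] (G x) := measurableSet_good hH M t hθ
  have hom : ∀ x, MeasurableSet {ω | o t ω = x} := fun x =>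
    ℱ.le (t + 1) _ (ho (measurableSet_singleton x))
  have hint : ∀ x, Integrable (fun ω => M.prob (gibbs H (θ t ω)) x) μ := fun x =>
    integrable_condExp.congr (hlaw x)
  have hsplit : A ∩ {ω | M.Good H κ (gibbs H (θ t ω)) (o t ω)} =
      ⋃ x, (A ∩ G x) ∩ {ω | o t ω = x} := by
    ext ω
    simp [hG]
  have hpiece : ∀ x, μ.real ((A ∩ G x) ∩ {ω | o t ω = x}) =
      ∫ ω in A, (G x).indicator (fun ω => M.prob (gibbs H (θ t ω)) x) ω ∂μ := by
    intro x
    have hS : MeasurableSet[ℱ t] (A ∩ G x) := hA.inter (hGm x)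
    have h1 := setIntegral_condExp (μ := μ) (ℱ.le t)
      (f := Set.indicator {ω | o t ω = x} (fun _ => (1 : ℝ)))
      ((integrable_const _).indicator (hom x)) hS
    rw [setIntegral_congr_ae (ℱ.le t _ hS) ((hlaw x).mono fun ω h _ => h),
      setIntegral_indicator (hom x), setIntegral_const, smul_eq_mul, mul_one] at h1
    rw [setIntegral_indicator (ℱ.le t _ (hGm x)), h1]
  have hdisj : Pairwise (Function.onFun Disjoint fun x => (A ∩ G x) ∩ {ω | o t ω = x}) := by
    intro x y hxy
    refine Set.disjoint_left.2 fun ω h1 h2 => hxy ?_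
    exact (h1.2 : o t ω = x).symm.trans h2.2
  have hunion := measureReal_iUnion_fintype (μ := μ) hdisj fun x =>
    ((ℱ.le t _ hA).inter (ℱ.le t _ (hGm x))).inter (hom x)
  rw [hsplit, hunion]
  simp only [hpiece]
  have hint' : ∀ x, Integrable ((G x).indicator fun ω => M.prob (gibbs H (θ t ω)) x)
      (μ.restrict A) := fun x => ((hint x).indicator (ℱ.le t _ (hGm x))).restrict
  rw [← integral_finsetSum _ fun x _ => hint' x]
  have hconst : π * μ.real A = ∫ _ in A, π ∂μ := by
    rw [setIntegral_const, smul_eq_mul, mul_comm]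
  rw [hconst]
  refine integral_mono (integrable_const _) (integrable_finsetSum _ fun x _ => hint' x) fun ω => ?_
  refine (hM _ (isDensity_gibbs hH (θ t ω))).trans (le_of_eq ?_)
  rw [Protocol.successProb, Finset.sum_filter]
  refine Finset.sum_congr rfl fun x _ => ?_
  rw [Set.indicator_apply]
  rfl

/-- The rounds need not be independent, since the states depend on the past; conditioning on past
success and using the worst-case guarantee gains a factor `π` per round. -/
theorem pow_le_measureReal_forall_good (hH : ∀ i, (H i).IsHermitian) (M : Protocol n N m) {π : ℝ}
    (hπ : 0 ≤ π) (hM : ∀ ρ : Op n, IsDensity ρ → π ≤ M.successProb H κ ρ)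
    {o : ℕ → Ω → Fin M.numOutcomes} {T : ℕ} (hθ : ∀ t, StronglyMeasurable[ℱ t] (θ t))
    (ho : ∀ t < T, Measurable[ℱ (t + 1)] (o t))
    (hlaw : ∀ t < T, ∀ x, μ[Set.indicator {ω | o t ω = x} (fun _ => (1 : ℝ)) | ℱ t] =ᵐ[μ]
      fun ω => M.prob (gibbs H (θ t ω)) x) :
    π ^ T ≤ μ.real {ω | ∀ t < T, M.Good H κ (gibbs H (θ t ω)) (o t ω)} := by
  have hsucc : ∀ k, {ω | ∀ t < k + 1, M.Good H κ (gibbs H (θ t ω)) (o t ω)} =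
      {ω | ∀ t < k, M.Good H κ (gibbs H (θ t ω)) (o t ω)} ∩
        {ω | M.Good H κ (gibbs H (θ k ω)) (o k ω)} := by
    intro k
    ext ω
    simp only [Set.mem_ofPred_eq, Set.mem_inter_iff, Nat.lt_succ_iff_lt_or_eq, or_imp, forall_and,
      forall_eq]
  -- Measurability of past success travels with the induction because that event is what the next
  -- round conditions on.
  have key : ∀ k ≤ T, MeasurableSet[ℱ k] {ω | ∀ t < k, M.Good H κ (gibbs H (θ t ω)) (o t ω)} ∧
      π ^ k ≤ μ.real {ω | ∀ t < k, M.Good H κ (gibbs H (θ t ω)) (o t ω)} := by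
    intro k
    induction k with
    | zero => intro _; simp
    | succ k ih =>
      intro hk
      obtain ⟨hA, hle⟩ := ih (by omega)
      rw [hsucc]
      constructor
      · refine MeasurableSet.inter (ℱ.mono (Nat.le_succ k) _ hA) ?_
        have : {ω | M.Good H κ (gibbs H (θ k ω)) (o k ω)} =
            ⋃ x, {ω | M.Good H κ (gibbs H (θ k ω)) x} ∩ {ω | o k ω = x} := by
          ext ω
          simp
        rw [this]
        exact MeasurableSet.iUnion fun x =>
          (ℱ.mono (Nat.le_succ k) _ (measurableSet_good hH M k (hθ k) x)).inter
            (ho k (by omega) (measurableSet_singleton x))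
      · refine le_trans ?_ (mul_measureReal_le hH M hM (hθ k) (ho k (by omega))
          (hlaw k (by omega)) hA)
        rw [pow_succ, mul_comm]
        exact mul_le_mul_of_nonneg_left hle hπ
  exact (key T le_rfl).2

end Rounds

end QBM

/-! ### Assembly -/

theorem theorem2 :
    ∃ c : ℝ, 0 < c ∧
      ∀ (n m : ℕ) (H : Fin m → QBM.Op n) (η : QBM.Op n) (Θ : Set (EuclideanSpace ℝ (Fin m)))
        (θ₀ θopt : EuclideanSpace ℝ (Fin m)) (α b κ ξ ε : ℝ) (T : ℕ),
        0 < m →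
        (∀ i, (H i).IsHermitian) →
        (∀ i, QBM.specNorm (H i) ≤ 1) →
        QBM.IsDensity η →
        0 < α → 0 < κ → 0 ≤ ξ → 0 < ε →
        -- the loss is `α`-strongly convex on `Θ`, which contains its global minimizer
        StrongConvexOn Θ α (QBM.loss H η) →
        θopt ∈ Θ →
        (∀ θ, QBM.loss H η θopt ≤ QBM.loss H η θ) →
        ε / (2 * m) ≤ κ ^ 2 + ξ ^ 2 →
        -- the maximal step is `1 / b`; `b = 4 * m ^ 2` is allowed
        4 * (m : ℝ) ≤ b →
        18 * (m : ℝ) ^ 2 * (κ ^ 2 + ξ ^ 2) / (α ^ 2 * ε ^ 2) ≤ T →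
        2 * b / α * Real.log (4 * (QBM.loss H η θ₀ - QBM.loss H η θopt) / ε ^ 2) ≤ T →
        -- precision after `T` iterations
        (∀ (Ω : Type*) [mΩ : MeasurableSpace Ω] (μ : Measure Ω) [IsProbabilityMeasure μ]
            (ℱ : Filtration ℕ mΩ) (θ : ℕ → Ω → EuclideanSpace ℝ (Fin m))
            (hρ hη : ℕ → Ω → Fin m → ℝ),
            QBM.IsSGDRun H η (QBM.stepSize α b T) κ ξ θ₀ T μ ℱ θ hρ hη →
            (∀ t ≤ T, ∀ᵐ ω ∂μ, θ t ω ∈ Θ) →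
            ∀ i, Integrable (fun ω =>
                |QBM.expVal (H i) (QBM.gibbs H (θ T ω)) - QBM.expVal (H i) η|) μ ∧
              ∫ ω, |QBM.expVal (H i) (QBM.gibbs H (θ T ω)) - QBM.expVal (H i) η| ∂μ ≤ ε) ∧
        -- number of preparations of the Gibbs state in each iteration
        ((∀ i, ∃ p : Fin n → Fin 4, H i = QBM.pauliString p) →
          ∀ lam : ℝ, 0 < lam → lam < 1 →
          ∃ M : QBM.Protocol n
              ⌈c * (1 / κ ^ 4) * Real.log (m / (1 - lam ^ (1 / (T : ℝ))))⌉₊ m,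
            (∀ ρ : QBM.Op n, QBM.IsDensity ρ →
              lam ^ (1 / (T : ℝ)) ≤ M.successProb H κ ρ) ∧
            -- success probability of `T` iterations, each on fresh preparations
            (∀ (Ω : Type*) [mΩ : MeasurableSpace Ω] (μ : Measure Ω) [IsProbabilityMeasure μ]
              (ℱ : Filtration ℕ mΩ) (θ : ℕ → Ω → EuclideanSpace ℝ (Fin m))
              (o : ℕ → Ω → Fin M.numOutcomes),
              (∀ t, StronglyMeasurable[ℱ t] (θ t)) →
              (∀ t < T, Measurable[ℱ (t + 1)] (o t)) →
              (∀ t < T, ∀ x, μ[Set.indicator {ω | o t ω = x} (fun _ => (1 : ℝ)) | ℱ t] =ᵐ[μ]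
                fun ω => M.prob (QBM.gibbs H (θ t ω)) x) →
              lam ≤ μ.real {ω | ∀ t < T, M.Good H κ (QBM.gibbs H (θ t ω)) (o t ω)})) := by
  refine ⟨768, by norm_num, ?_⟩
  intro n m H η Θ θ₀ θopt α b κ ξ ε T hm hH hH1 hη hα hκ _ hε hsc hoptΘ hopt _ hb hT1 hT2
  have hm' : (0 : ℝ) < m := by exact_mod_cast hm
  -- Since `κ > 0`, the first condition forces `T ≥ 1`, so the exponent `1 / T` is meaningful.
  have hT0 : (0 : ℝ) < T := lt_of_lt_of_le (by positivity) hT1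
  refine ⟨?_, ?_⟩
  · intro Ω mΩ μ _ ℱ θ hρ hη' run hΘ i
    exact ⟨((run.memLp_lossGrad hH hH1 T i).integrable (by norm_num)).abs,
      run.integral_abs_lossGrad_le hH hη hH1 hm hα hκ hε hsc hoptΘ hopt hb hT1 hT2 hΘ i⟩
  · intro hpauli lam hlam0 hlam1
    choose p hp using hpauli
    have hHp : H = fun i => QBM.pauliString (p i) := funext hp
    have hπ0 : 0 < lam ^ (1 / (T : ℝ)) := Real.rpow_pos_of_pos hlam0 _
    have hπ1 : lam ^ (1 / (T : ℝ)) < 1 :=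
      Real.rpow_lt_one hlam0.le hlam1 (by positivity)
    obtain ⟨M, hM⟩ := QBM.exists_protocol hm p hκ hπ0 hπ1 (Nat.le_ceil _)
    rw [← hHp] at hM
    refine ⟨M, hM, ?_⟩
    intro Ω mΩ μ _ ℱ θ o hθ ho hlaw
    have hpow : (lam ^ (1 / (T : ℝ))) ^ T = lam := by
      rw [← Real.rpow_natCast, ← Real.rpow_mul hlam0.le, one_div, inv_mul_cancel₀ hT0.ne',
        Real.rpow_one]
    exact hpow.ge.trans (QBM.pow_le_measureReal_forall_good hH M hπ0.le hM hθ ho hlaw)
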